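/- Let $(\mathcal A,\varphi)$ be a non-commutative probability space, i.e. a unital associative algebra $\mathcal A$ over $\mathbb C$ with a linear functional $\varphi:\mathcal A\to\mathbb C$ satisfying $\varphi(1)=1$. For $n\ge 1$ let $NC(n)$ be the set of non-crossing partitions of $\{1,\dots,n\}$, i.e. of those partitions $\pi$ for which there are no $p_1<q_1<p_2<q_2$ such that $p_1,p_2$ lie in one block of $\pi$ and $q_1,q_2$ in another block of $\pi$. It is partially ordered by: $\pi\le\sigma$ iff every block of $\pi$ is contained in a block of $\sigma$; its maximum is $1_n=\{\{1,\dots,n\}\}$, and $\mu$ denotes its Möbius function. For $\pi\in NC(n)$ and $a_1,\dots,a_n\in\mathcal A$ put $$\varphi_\pi(a_1,\dots,a_n)=\prod_{V=\{i_1<\dots<i_s\}\in\pi}\varphi(a_{i_1}a_{i_2}\cdots a_{i_s}),$$ and define the free cumulants by $$\kappa_n(a_1,\dots,a_n)=\sum_{\pi\in NC(n)}\varphi_\pi(a_1,\dots,a_n)\,\mu(\pi,1_n).$$ Unital subalgebras $(\mathcal A_i)_{i\in I}$ of $\mathcal A$ are called freely independent if $\varphi(a_1\cdots a_k)=0$ whenever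 $k\ge 1$, $i(1),\dots,i(k)\in I$ with $i(j)\ne i(j+1)$ for $1\le j<k$, $a_j\in\mathcal A_{i(j)}$ and $\varphi(a_j)=0$ for all $1\le j\le k$. Elements $(x_i)_{i\in I}$ of $\mathcal A$ are called freely independent if the unital subalgebras generated by the single elements $x_i$, $i\in I$, are freely independent. (1) Let $(\mathcal A_i)_{i\in I}$ be a family of unital subalgebras of $\mathcal A$. Then $(\mathcal A_i)_{i\in I}$ are freely independent if and only if for all $n\ge 2$, all $i:\{1,\dots,n\}\to I$ and all $a_1,\dots,a_n\in\mathcal A$ with $a_j\in\mathcal A_{i(j)}$ for every $j$, one has $\kappa_n(a_1,\dots,a_n)=0$ whenever there exist $l,k$ with $i(l)\ne i(k)$. (2) Let $(x_i)_{i\in I}$ be a family of elements of $\mathcal A$. Then $(x_i)_{i\in I}$ are freely independent if and only if for all $n\ge 2$ and all $i:\{1,\dots,n\}\to I$, one has $\kappa_n(x_{i(1)},\dots,x_{i(n)})=0$ whenever there exist $l,k$ with $i(l)\ne i(k)$. -/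

import Mathlib

namespace FreeProb

/-- `p ∼_π q`: the points `p` and `q` lie in the same block of `π`. -/
def SameBlock {n : ℕ} (π : Finpartition (Finset.univ : Finset (Fin n))) (p q : Fin n) : Prop :=
  ∃ V ∈ π.parts, p ∈ V ∧ q ∈ V

/-- A partition of `{1, …, n}` is crossing if there are `p₁ < q₁ < p₂ < q₂` with
`p₁ ∼ p₂`, `q₁ ∼ q₂` and `p₁ ≁ q₁`. -/
def IsCrossing {n : ℕ} (π : Finpartition (Finset.univ : Finset (Fin n))) : Prop :=
  ∃ p₁ q₁ p₂ q₂ : Fin n, p₁ < q₁ ∧ q₁ < p₂ ∧ p₂ < q₂ ∧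
    SameBlock π p₁ p₂ ∧ SameBlock π q₁ q₂ ∧ ¬ SameBlock π p₁ q₁

/-- The set `NC(n)` of non-crossing partitions of an `n`-element totally ordered set. The order is
the one inherited from `Finpartition`: `π ≤ σ` iff every block of `π` is contained in a block
of `σ`. -/
abbrev NC (n : ℕ) : Type :=
  {π : Finpartition (Finset.univ : Finset (Fin n)) // ¬ IsCrossing π}

noncomputable instance instFintypeNC (n : ℕ) : Fintype (NC n) := Fintype.ofFinite _

open scoped Classical in
noncomputable instance instLocallyFiniteOrderNC (n : ℕ) : LocallyFiniteOrder (NC n) :=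
  Fintype.toLocallyFiniteOrder

theorem not_isCrossing_top (n : ℕ) :
    ¬ IsCrossing (⊤ : Finpartition (Finset.univ : Finset (Fin n))) := by
  rintro ⟨p, q, -, -, -, -, -, -, -, h⟩
  apply h
  obtain ⟨V, hV, hp⟩ :=
    (⊤ : Finpartition (Finset.univ : Finset (Fin n))).exists_mem (Finset.mem_univ p)
  have hVu : V = Finset.univ := by
    simpa using Finpartition.parts_top_subset (Finset.univ : Finset (Fin n)) hV
  exact ⟨V, hV, hp, by simp [hVu]⟩

/-- The maximal element `1_n` of `NC(n)`; for `n ≥ 1` its only block is the whole set. -/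
def NC.one (n : ℕ) : NC n := ⟨⊤, not_isCrossing_top n⟩

section

variable {A : Type*} [Ring A] [Algebra ℂ A]

/-- The moment functional `φ_n(a_1, …, a_n) = φ(a_1 ⋯ a_n)`. -/
def moment (φ : A →ₗ[ℂ] ℂ) {n : ℕ} (a : Fin n → A) : ℂ :=
  φ (List.ofFn a).prod

/-- `φ_{#V}(a_1, …, a_n ∣ V) = φ_s(a_{i_1}, …, a_{i_s})` for `V = {i_1 < ⋯ < i_s}`. -/
def momentOn (φ : A →ₗ[ℂ] ℂ) {n : ℕ} (a : Fin n → A) (V : Finset (Fin n)) : ℂ :=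
  moment φ (fun j : Fin V.card => a (V.orderEmbOfFin rfl j))

/-- The multiplicative family `φ_π(a_1, …, a_n) = ∏_{V ∈ π} φ_{#V}(a_1, …, a_n ∣ V)`. -/
def momentNC (φ : A →ₗ[ℂ] ℂ) {n : ℕ} (π : NC n) (a : Fin n → A) : ℂ :=
  ∏ V ∈ π.1.parts, momentOn φ a V

open scoped Classical in
/-- The free cumulants `κ_σ(a_1, …, a_n) = ∑_{π ∈ NC(n), π ≤ σ} φ_π(a_1, …, a_n) μ(π, σ)`, where
`μ` is the Möbius function of the finite poset `NC(n)`. -/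
noncomputable def cumulantNC (φ : A →ₗ[ℂ] ℂ) {n : ℕ} (σ : NC n) (a : Fin n → A) : ℂ :=
  ∑ π : NC n with π ≤ σ, momentNC φ π a * IncidenceAlgebra.mu ℂ π σ

/-- The free cumulant `κ_n = κ_{1_n}`. -/
noncomputable def freeCumulant (φ : A →ₗ[ℂ] ℂ) {n : ℕ} (a : Fin n → A) : ℂ :=
  cumulantNC φ (NC.one n) a

/-- Free independence of unital subalgebras `(𝒜_i)_{i ∈ I}` with respect to `φ`:
`φ(a_1 ⋯ a_k) = 0` for all `k ≥ 1`, all `i(1) ≠ i(2) ≠ ⋯ ≠ i(k)` (neighbouring indices are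
different) and all `a_j ∈ 𝒜_{i(j)}` with `φ(a_j) = 0`. -/
def IsFree (φ : A →ₗ[ℂ] ℂ) {I : Type*} (𝒜 : I → Subalgebra ℂ A) : Prop :=
  ∀ (k : ℕ), 1 ≤ k → ∀ (i : Fin k → I) (a : Fin k → A),
    (∀ j, a j ∈ 𝒜 (i j)) →
    (∀ j j' : Fin k, (j : ℕ) + 1 = (j' : ℕ) → i j ≠ i j') →
    (∀ j, φ (a j) = 0) →
    φ (List.ofFn a).prod = 0

/-- Random variables are free if the unital subalgebras they generate are free. -/
def IsFreeRV (φ : A →ₗ[ℂ] ℂ) {I : Type*} (x : I → A) : Prop :=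
  IsFree φ (fun i => Algebra.adjoin ℂ {x i})

end

end FreeProb

/-! Everything rests on the moment-cumulant relation: the moment of a word is the sum over
non-crossing partitions of the products of the cumulants of the blocks (`ncSum_cumulant`). This
system is triangular, so cumulants are its unique solution. An identity between cumulants is
therefore proved by exhibiting a weight on finite sets with the right sums (`eq_cumulant`). Möbius
inversion on `NC n` identifies this solution with `freeCumulant` (`freeCumulant_eq_cumulant`).

Vanishing of mixed cumulants implies freeness, because every non-crossing partition has a block that
is a singleton or contains two neighbours (`ncSum_eq_zero`). For a centred alternating word both
kinds of block have cumulant zero, hence so does the moment.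

The converse is an induction on the length of the word. If two neighbours have the same colour they
are multiplied together. By `cumulant_mergeLetters` the cumulant of the shorter word is that of the
longer one plus products of two smaller cumulants, and in a mixed word one factor of each product is
mixed. If neighbours always differ, multilinearity and the vanishing of cumulants with an entry `1`
allow every letter to be centred. Then the moment vanishes by freeness, every partition with more
than one block contributes zero, and the full cumulant is what remains.

For single variables, the same product formula carries the vanishing from the generators to their
powers, and multilinearity carries it on to the generated algebras. -/

namespace FreeProb

/-! ### Weighted sums over non-crossing partitions -/

section NCSum

variable {ι : Type*} [LinearOrder ι]

/-- Two finite sets `W` and `X` do not cross. -/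
def NonCrossing (W X : Finset ι) : Prop :=
  ∀ p₁ q₁ p₂ q₂ : ι, p₁ < q₁ → q₁ < p₂ → p₂ < q₂ →
    ¬(p₁ ∈ W ∧ p₂ ∈ W ∧ q₁ ∈ X ∧ q₂ ∈ X) ∧ ¬(p₁ ∈ X ∧ p₂ ∈ X ∧ q₁ ∈ W ∧ q₂ ∈ W)

theorem NonCrossing.symm {W X : Finset ι} (h : NonCrossing W X) : NonCrossing X W :=
  fun p₁ q₁ p₂ q₂ h₁ h₂ h₃ => (h p₁ q₁ p₂ q₂ h₁ h₂ h₃).symm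

theorem NonCrossing.mono {W W' X X' : Finset ι} (h : NonCrossing W X) (hW : W' ⊆ W)
    (hX : X' ⊆ X) : NonCrossing W' X' :=
  fun p₁ q₁ p₂ q₂ h₁ h₂ h₃ =>
    ⟨fun ⟨a, b, c, d⟩ => (h p₁ q₁ p₂ q₂ h₁ h₂ h₃).1 ⟨hW a, hW b, hX c, hX d⟩,
      fun ⟨a, b, c, d⟩ => (h p₁ q₁ p₂ q₂ h₁ h₂ h₃).2 ⟨hX a, hX b, hW c, hW d⟩⟩

theorem nonCrossing_singleton (j : ι) (X : Finset ι) : NonCrossing {j} X := by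
  intro p₁ q₁ p₂ q₂ h₁ h₂ h₃
  simp only [Finset.mem_singleton]
  constructor
  · rintro ⟨rfl, rfl, -⟩
    exact lt_asymm h₁ h₂
  · rintro ⟨-, -, rfl, rfl⟩
    exact lt_asymm h₂ h₃

theorem nonCrossing_map {κ : Type*} [LinearOrder κ] (e : κ ↪o ι) (W X : Finset κ) :
    NonCrossing (W.map e.toEmbedding) (X.map e.toEmbedding) ↔ NonCrossing W X := by
  constructor
  · intro h p₁ q₁ p₂ q₂ h₁ h₂ h₃
    simpa using h (e p₁) (e q₁) (e p₂) (e q₂) (by simpa) (by simpa) (by simpa)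
  · intro h p₁ q₁ p₂ q₂ h₁ h₂ h₃
    simp only [Finset.mem_map, RelEmbedding.coe_toEmbedding]
    constructor
    · rintro ⟨⟨a, ha, rfl⟩, ⟨b, hb, rfl⟩, ⟨c, hc, rfl⟩, ⟨d, hd, rfl⟩⟩
      exact (h a c b d (by simpa using h₁) (by simpa using h₂) (by simpa using h₃)).1
        ⟨ha, hb, hc, hd⟩
    · rintro ⟨⟨a, ha, rfl⟩, ⟨b, hb, rfl⟩, ⟨c, hc, rfl⟩, ⟨d, hd, rfl⟩⟩
      exact (h a c b d (by simpa using h₁) (by simpa using h₂) (by simpa using h₃)).2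
        ⟨ha, hb, hc, hd⟩

/-- `P` is the set of blocks of a non-crossing partition of the finite set `V`. -/
structure IsNCPartition (V : Finset ι) (P : Finset (Finset ι)) : Prop where
  nonempty : ∀ W ∈ P, W.Nonempty
  subset : ∀ W ∈ P, W ⊆ V
  cover : ∀ x ∈ V, ∃ W ∈ P, x ∈ W
  disjoint : ∀ W ∈ P, ∀ X ∈ P, W ≠ X → Disjoint W X
  nonCrossing : ∀ W ∈ P, ∀ X ∈ P, W ≠ X → NonCrossing W X

open scoped Classical in
/-- The finite set of non-crossing partitions of `V`. -/
noncomputable def ncPartitions (V : Finset ι) : Finset (Finset (Finset ι)) :=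
  {P ∈ V.powerset.powerset | IsNCPartition V P}

theorem mem_ncPartitions {V : Finset ι} {P : Finset (Finset ι)} :
    P ∈ ncPartitions V ↔ IsNCPartition V P := by
  simp only [ncPartitions, Finset.mem_filter, and_iff_right_iff_imp, Finset.mem_powerset]
  exact fun h W hW => Finset.mem_powerset.2 (h.subset W hW)

/-- The sum over the non-crossing partitions of `V` of the product of the weights of the blocks. -/
noncomputable def ncSum (f : Finset ι → ℂ) (V : Finset ι) : ℂ :=
  ∑ P ∈ ncPartitions V, ∏ W ∈ P, f W

open scoped Classical in
/-- The weight `f`, set to zero on the blocks that cross `W`. -/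
noncomputable def avoiding (W : Finset ι) (f : Finset ι → ℂ) : Finset ι → ℂ :=
  fun X => if NonCrossing W X then f X else 0

theorem avoiding_congr {κ : Type*} [LinearOrder κ] {W X : Finset ι} {W' X' : Finset κ}
    {f : Finset ι → ℂ} {g : Finset κ → ℂ} (h : NonCrossing W X ↔ NonCrossing W' X')
    (hfg : f X = g X') : avoiding W f X = avoiding W' g X' := by
  by_cases hc : NonCrossing W' X'
  · simp only [avoiding, if_pos hc, if_pos (h.2 hc), hfg]
  · simp only [avoiding, if_neg hc, if_neg (mt h.1 hc)]

theorem ncSum_congr {f g : Finset ι → ℂ} {V : Finset ι}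
    (h : ∀ W ⊆ V, W.Nonempty → f W = g W) : ncSum f V = ncSum g V := by
  refine Finset.sum_congr rfl fun P hP => Finset.prod_congr rfl fun W hW => ?_
  rw [mem_ncPartitions] at hP
  exact h W (hP.subset W hW) (hP.nonempty W hW)

@[simp]
theorem ncSum_empty (f : Finset ι → ℂ) : ncSum f ∅ = 1 := by
  have : ncPartitions (∅ : Finset ι) = {∅} := by
    ext P
    rw [mem_ncPartitions, Finset.mem_singleton]
    constructor
    · intro h
      refine Finset.eq_empty_of_forall_notMem fun W hW => ?_
      have h₁ := h.nonempty W hW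
      rw [Finset.subset_empty.1 (h.subset W hW)] at h₁
      exact Finset.not_nonempty_empty h₁
    · rintro rfl
      constructor <;> simp
  simp [ncSum, this]

theorem IsNCPartition.eq_of_mem {V : Finset ι} {P : Finset (Finset ι)} (h : IsNCPartition V P)
    {W X : Finset ι} (hW : W ∈ P) (hX : X ∈ P) {x : ι} (hxW : x ∈ W) (hxX : x ∈ X) : W = X := by
  by_contra hne
  exact Finset.disjoint_left.1 (h.disjoint W hW X hX hne) hxW hxX

theorem IsNCPartition.erase {V : Finset ι} {P : Finset (Finset ι)} (h : IsNCPartition V P)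
    {W : Finset ι} (hW : W ∈ P) : IsNCPartition (V \ W) (P.erase W) where
  nonempty X hX := h.nonempty X (Finset.mem_of_mem_erase hX)
  subset X hX := by
    rw [Finset.mem_erase] at hX
    exact Finset.subset_sdiff.2 ⟨h.subset X hX.2, h.disjoint X hX.2 W hW hX.1⟩
  cover x hx := by
    rw [Finset.mem_sdiff] at hx
    obtain ⟨X, hX, hxX⟩ := h.cover x hx.1
    refine ⟨X, Finset.mem_erase.2 ⟨?_, hX⟩, hxX⟩
    rintro rfl
    exact hx.2 hxX
  disjoint X hX Y hY :=
    h.disjoint X (Finset.mem_of_mem_erase hX) Y (Finset.mem_of_mem_erase hY)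
  nonCrossing X hX Y hY :=
    h.nonCrossing X (Finset.mem_of_mem_erase hX) Y (Finset.mem_of_mem_erase hY)

theorem IsNCPartition.notMem_of_sdiff {V W : Finset ι} {Q : Finset (Finset ι)}
    (h : IsNCPartition (V \ W) Q) : W ∉ Q := fun hW => by
  obtain ⟨x, hx⟩ := h.nonempty W hW
  exact (Finset.mem_sdiff.1 (h.subset W hW hx)).2 hx

theorem IsNCPartition.insert {V W : Finset ι} {Q : Finset (Finset ι)}
    (h : IsNCPartition (V \ W) Q) (hWV : W ⊆ V) (hW : W.Nonempty)
    (hc : ∀ X ∈ Q, NonCrossing W X) : IsNCPartition V (insert W Q) where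
  nonempty := by
    simp only [Finset.mem_insert, forall_eq_or_imp]
    exact ⟨hW, h.nonempty⟩
  subset := by
    simp only [Finset.mem_insert, forall_eq_or_imp]
    exact ⟨hWV, fun X hX => (h.subset X hX).trans Finset.sdiff_subset⟩
  cover x hx := by
    by_cases hxW : x ∈ W
    · exact ⟨W, Finset.mem_insert_self _ _, hxW⟩
    · obtain ⟨X, hX, hxX⟩ := h.cover x (Finset.mem_sdiff.2 ⟨hx, hxW⟩)
      exact ⟨X, Finset.mem_insert_of_mem hX, hxX⟩
  disjoint := by
    have h' : ∀ X ∈ Q, Disjoint W X := fun X hX =>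
      (Finset.subset_sdiff.1 (h.subset X hX)).2.symm
    simp only [Finset.mem_insert, forall_eq_or_imp]
    exact ⟨⟨fun hn => absurd rfl hn, fun X hX _ => h' X hX⟩,
      fun X hX => ⟨fun _ => (h' X hX).symm, fun Y hY => h.disjoint X hX Y hY⟩⟩
  nonCrossing := by
    simp only [Finset.mem_insert, forall_eq_or_imp]
    exact ⟨⟨fun hn => absurd rfl hn, fun X hX _ => hc X hX⟩,
      fun X hX => ⟨fun _ => (hc X hX).symm, fun Y hY => h.nonCrossing X hX Y hY⟩⟩

-- Erasing the block `W` is a bijection onto the partitions of `V \ W` none of whose blocks crosses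
-- `W`; `avoiding` encodes that condition in the weight, so what is left is again an `ncSum`.
open scoped Classical in
theorem mul_ncSum_avoiding (f : Finset ι → ℂ) {V W : Finset ι} (hWV : W ⊆ V) (hW : W.Nonempty) :
    f W * ncSum (avoiding W f) (V \ W) =
      ∑ P ∈ ncPartitions V with W ∈ P, ∏ X ∈ P, f X := by
  have h₁ : ncSum (avoiding W f) (V \ W) =
      ∑ Q ∈ ncPartitions (V \ W) with ∀ X ∈ Q, NonCrossing W X, ∏ X ∈ Q, f X := by
    rw [ncSum, Finset.sum_filter]
    refine Finset.sum_congr rfl fun Q _ => ?_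
    split_ifs with h
    · exact Finset.prod_congr rfl fun X hX => if_pos (h X hX)
    · push Not at h
      obtain ⟨X, hX, hc⟩ := h
      exact Finset.prod_eq_zero hX (if_neg hc)
  rw [h₁, Finset.mul_sum]
  symm
  refine Finset.sum_bij' (fun P _ => P.erase W) (fun Q _ => insert W Q) ?_ ?_ ?_ ?_ ?_
  · intro P hP
    simp only [Finset.mem_filter, mem_ncPartitions] at hP ⊢
    refine ⟨hP.1.erase hP.2, fun X hX => ?_⟩
    rw [Finset.mem_erase] at hX
    exact hP.1.nonCrossing W hP.2 X hX.2 hX.1.symm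
  · intro Q hQ
    simp only [Finset.mem_filter, mem_ncPartitions] at hQ ⊢
    exact ⟨hQ.1.insert hWV hW hQ.2, Finset.mem_insert_self _ _⟩
  · intro P hP
    exact Finset.insert_erase (Finset.mem_filter.1 hP).2
  · intro Q hQ
    simp only [Finset.mem_filter, mem_ncPartitions] at hQ
    exact Finset.erase_insert hQ.1.notMem_of_sdiff
  · intro P hP
    exact (Finset.mul_prod_erase _ _ (Finset.mem_filter.1 hP).2).symm

/-- Expansion of a sum over non-crossing partitions along the block of a given element. -/
theorem ncSum_eq_sum_block (f : Finset ι → ℂ) {V : Finset ι} {j : ι} (hj : j ∈ V) :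
    ncSum f V = ∑ W ∈ V.powerset with j ∈ W, f W * ncSum (avoiding W f) (V \ W) := by
  classical
  have h₁ : ∀ W ∈ V.powerset.filter (fun W => j ∈ W), f W * ncSum (avoiding W f) (V \ W) =
      ∑ P ∈ ncPartitions V, if W ∈ P then ∏ X ∈ P, f X else 0 := by
    intro W hW
    simp only [Finset.mem_filter, Finset.mem_powerset] at hW
    rw [mul_ncSum_avoiding f hW.1 ⟨j, hW.2⟩, Finset.sum_filter]
  rw [Finset.sum_congr rfl h₁, Finset.sum_comm, ncSum]
  refine Finset.sum_congr rfl fun P hP => ?_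
  rw [mem_ncPartitions] at hP
  obtain ⟨W, hW, hjW⟩ := hP.cover j hj
  rw [Finset.sum_eq_single W, if_pos hW]
  · intro X hX hne
    refine if_neg fun hXP => hne ?_
    exact hP.eq_of_mem hXP hW (Finset.mem_filter.1 hX).2 hjW
  · intro h
    exact absurd (Finset.mem_filter.2 ⟨Finset.mem_powerset.2 (hP.subset W hW), hjW⟩) h

/-- Two sums over non-crossing partitions agree if the weights agree on proper subsets and on
the whole set. -/
theorem ncSum_sub_ncSum {f g : Finset ι → ℂ} {V : Finset ι} (hV : V.Nonempty)
    (h : ∀ W ⊂ V, W.Nonempty → f W = g W) : ncSum f V - ncSum g V = f V - g V := by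
  obtain ⟨j, hj⟩ := hV
  rw [ncSum_eq_sum_block f hj, ncSum_eq_sum_block g hj, ← Finset.sum_sub_distrib,
    Finset.sum_eq_single V]
  · simp
  · intro W hW hne
    simp only [Finset.mem_filter, Finset.mem_powerset] at hW
    have hss : W ⊂ V := hW.1.ssubset_of_ne hne
    rw [h W hss ⟨j, hW.2⟩, sub_eq_zero]
    congr 1
    refine ncSum_congr fun X hX hXn => ?_
    have hX' : X ⊂ V := by
      refine (hX.trans Finset.sdiff_subset).ssubset_of_ne ?_
      rintro rfl
      exact (Finset.mem_sdiff.1 (hX hj)).2 hW.2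
    simp only [avoiding, h X hX' hXn]
  · intro h
    simp [hj] at h

/-- Triangularity: in the sum over partitions of `V`, the value `f V` occurs only in the one-block
term, and all other blocks are proper subsets. -/
theorem eq_of_ncSum_eq {f g : Finset ι → ℂ} (V : Finset ι) (hV : V.Nonempty)
    (h : ∀ W ⊆ V, W.Nonempty → ncSum f W = ncSum g W) : f V = g V := by
  induction V using Finset.strongInduction with
  | H V ih =>
    have h₁ := ncSum_sub_ncSum (f := f) (g := g) hV fun W hW hWn =>
      ih W hW hWn fun X hX => h X (hX.trans hW.subset)
    rw [h V subset_rfl hV, sub_self] at h₁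
    exact sub_eq_zero.1 h₁.symm

theorem ncSum_map {κ : Type*} [LinearOrder κ] (e : κ ↪o ι) (f : Finset ι → ℂ) (V : Finset κ) :
    ncSum (fun W => f (W.map e.toEmbedding)) V = ncSum f (V.map e.toEmbedding) := by
  -- The weight is generalised because splitting off a block `W` replaces it by `avoiding W f`.
  induction V using Finset.strongInduction generalizing f with
  | H V ih =>
    rcases V.eq_empty_or_nonempty with rfl | ⟨j, hj⟩
    · simp
    have hj' : e j ∈ V.map e.toEmbedding := by simpa using hj
    rw [ncSum_eq_sum_block _ hj, ncSum_eq_sum_block _ hj']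
    refine Finset.sum_bij (fun W _ => W.map e.toEmbedding) ?_ ?_ ?_ ?_
    · intro W hW
      simpa using hW
    · intro W _ X _ h
      exact Finset.map_injective _ h
    · intro W hW
      simp only [Finset.mem_filter, Finset.mem_powerset] at hW
      obtain ⟨X, hX, rfl⟩ := Finset.subset_map_iff.1 hW.1
      refine ⟨X, ?_, rfl⟩
      simp only [Finset.mem_filter, Finset.mem_powerset]
      exact ⟨hX, by simpa using hW.2⟩
    · intro W hW
      simp only [Finset.mem_filter, Finset.mem_powerset] at hW
      have hss : V \ W ⊂ V := Finset.sdiff_ssubset hW.1 ⟨j, hW.2⟩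
      rw [← Finset.map_sdiff, ← ih _ hss]
      congr 1
      refine ncSum_congr fun X _ _ => ?_
      exact avoiding_congr (nonCrossing_map e W X).symm rfl

/-- Under `h₀` no contributing block meets both sets, and under `hc` contributing blocks on
different sides never cross, so the two partitions are chosen independently. -/
theorem ncSum_union (f : Finset ι → ℂ) (U V : Finset ι) (hd : Disjoint U V)
    (h₀ : ∀ W ⊆ U ∪ V, ∀ x ∈ W, ∀ y ∈ W, x ∈ U → y ∈ V → f W = 0)
    (hc : ∀ W ⊆ U, ∀ X ⊆ V, f W ≠ 0 → f X ≠ 0 → NonCrossing W X) :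
    ncSum f (U ∪ V) = ncSum f U * ncSum f V := by
  induction U using Finset.strongInduction generalizing f with
  | H U ih =>
    rcases U.eq_empty_or_nonempty with rfl | ⟨j, hj⟩
    · simp
    rw [ncSum_eq_sum_block f (Finset.mem_union_left V hj), ncSum_eq_sum_block f hj,
      Finset.sum_mul]
    symm
    refine Finset.sum_subset_zero_on_sdiff ?_ ?_ ?_
    · intro W hW
      simp only [Finset.mem_filter, Finset.mem_powerset] at hW ⊢
      exact ⟨hW.1.trans Finset.subset_union_left, hW.2⟩
    · intro W hW
      simp only [Finset.mem_sdiff, Finset.mem_filter, Finset.mem_powerset, not_and'] at hW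
      obtain ⟨y, hy, hyU⟩ := Finset.not_subset.1 (hW.2 hW.1.2)
      have hyV : y ∈ V := (Finset.mem_union.1 (hW.1.1 hy)).resolve_left hyU
      rw [h₀ W hW.1.1 j hW.1.2 y hy hj hyV, zero_mul]
    · intro W hW
      simp only [Finset.mem_filter, Finset.mem_powerset] at hW
      have hss : U \ W ⊂ U := Finset.sdiff_ssubset hW.1 ⟨j, hW.2⟩
      have hWV : V \ W = V := Finset.sdiff_eq_self_of_disjoint (hd.symm.mono_right hW.1)
      rw [Finset.union_sdiff_distrib, hWV]
      by_cases hfW : f W = 0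
      · simp [hfW]
      rw [ih (U \ W) hss (avoiding W f) (hd.mono_left Finset.sdiff_subset), mul_assoc]
      · congr 2
        refine ncSum_congr fun X hX _ => ?_
        by_cases hfX : f X = 0
        · simp [avoiding, hfX]
        · exact (if_pos (hc W hW.1 X hX hfW hfX)).symm
      · intro X hX x hx y hy hxU hyV
        simp only [avoiding]
        rw [h₀ X (hX.trans (Finset.union_subset_union_left Finset.sdiff_subset)) x hx y hy
          (Finset.sdiff_subset hxU) hyV, ite_self]
      · intro X hX Y hY hfX hfY
        refine hc X (hX.trans Finset.sdiff_subset) Y hY ?_ ?_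
        · contrapose! hfX
          simp [avoiding, hfX]
        · contrapose! hfY
          simp [avoiding, hfY]

/-- A weight that vanishes on singletons and on the blocks that contain two neighbouring elements
of `V` has vanishing sum over the non-crossing partitions of `V`. -/
theorem ncSum_eq_zero (f : Finset ι → ℂ) {V : Finset ι} (hV : V.Nonempty)
    (h₁ : ∀ j ∈ V, f {j} = 0)
    (h₂ : ∀ W ⊆ V, ∀ p ∈ W, ∀ q ∈ W, p < q → (∀ r ∈ V, ¬(p < r ∧ r < q)) → f W = 0) :
    ncSum f V = 0 := by
  refine Finset.sum_eq_zero fun P hP => ?_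
  rw [mem_ncPartitions] at hP
  by_contra hne
  rw [← ne_eq, Finset.prod_ne_zero_iff] at hne
  -- Descent on the number of points of `V` between two points `p < q` of one block. Given `r`
  -- between them, its block is not a singleton; if it differs from `W`, non-crossing traps it
  -- between `p` and `q`. Either way a pair with a smaller gap appears.
  have key : ∀ n : ℕ, ∀ W ∈ P, ∀ p ∈ W, ∀ q ∈ W, p < q →
      (V.filter fun r => p < r ∧ r < q).card = n → False := by
    intro n
    induction n using Nat.strong_induction_on with
    | _ n ih =>
      intro W hW p hp q hq hpq hn
      have hWV := hP.subset W hW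
      have : ∃ r ∈ V, p < r ∧ r < q := by
        by_contra! hcon
        exact hne W hW (h₂ W hWV p hp q hq hpq fun r hr hh => absurd hh.2 (not_lt.2 (hcon r hr hh.1)))
      obtain ⟨r, hr, hpr, hrq⟩ := this
      have step : ∀ X ∈ P, ∀ p' ∈ X, ∀ q' ∈ X, p ≤ p' → p' < q' → q' ≤ q →
          (p' = r ∨ q' = r) → False := by
        intro X hX p' hp' q' hq' hpp hpq' hqq hr'
        refine ih _ ?_ X hX p' hp' q' hq' hpq' rfl
        rw [← hn]
        refine Finset.card_lt_card ((Finset.ssubset_iff_of_subset ?_).2 ⟨r, ?_, ?_⟩)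
        · intro s hs
          simp only [Finset.mem_filter] at hs ⊢
          exact ⟨hs.1, hpp.trans_lt hs.2.1, hs.2.2.trans_le hqq⟩
        · simp [hr, hpr, hrq]
        · rcases hr' with rfl | rfl <;> simp
      obtain ⟨X, hX, hrX⟩ := hP.cover r hr
      by_cases hXs : X = {r}
      · exact hne X hX (hXs ▸ h₁ r hr)
      obtain ⟨s, hs, hsr⟩ : ∃ s ∈ X, s ≠ r := by
        by_contra! hcon
        exact hXs (Finset.eq_singleton_iff_unique_mem.2 ⟨hrX, hcon⟩)
      by_cases hXW : X = W
      · subst hXW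
        exact step X hX p hp r hrX le_rfl hpr hrq.le (Or.inr rfl)
      have hnc := hP.nonCrossing X hX W hW hXW
      have hdj := hP.disjoint X hX W hW hXW
      have hsp : s ≠ p := fun h => Finset.disjoint_left.1 hdj hs (h ▸ hp)
      have hsq : s ≠ q := fun h => Finset.disjoint_left.1 hdj hs (h ▸ hq)
      rcases lt_or_gt_of_ne hsp with h | h
      · exact (hnc s p r q h hpr hrq).1 ⟨hs, hrX, hp, hq⟩
      rcases lt_or_gt_of_ne hsq with h' | h'
      · rcases lt_or_gt_of_ne hsr with h'' | h''
        · exact step X hX s hs r hrX h.le h'' hrq.le (Or.inr rfl)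
        · exact step X hX r hrX s hs hpr.le h'' h'.le (Or.inl rfl)
      · exact (hnc p r q s hpr hrq h').2 ⟨hp, hq, hrX, hs⟩
  obtain ⟨j, hj⟩ := hV
  obtain ⟨W, hW, hjW⟩ := hP.cover j hj
  by_cases hWs : W = {j}
  · exact hne W hW (hWs ▸ h₁ j hj)
  obtain ⟨s, hs, hsj⟩ : ∃ s ∈ W, s ≠ j := by
    by_contra! hcon
    exact hWs (Finset.eq_singleton_iff_unique_mem.2 ⟨hjW, hcon⟩)
  rcases lt_or_gt_of_ne hsj with h | h
  · exact key _ W hW s hs j hjW h rfl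
  · exact key _ W hW j hjW s hs h rfl

end NCSum

/-! ### Abstract cumulants and the merging of neighbours -/

section Cum

variable {ι : Type*} [LinearOrder ι]

open scoped Classical in
/-- The cumulant function of a set function `m`: the weight whose sums over non-crossing
partitions are `m`. -/
noncomputable def cum (m : Finset ι → ℂ) (V : Finset ι) : ℂ :=
  m V - ncSum (fun W => if _h : W ⊂ V then cum m W else 0) V
termination_by V.card
decreasing_by exact Finset.card_lt_card _h

theorem ncSum_cum (m : Finset ι → ℂ) {V : Finset ι} (hV : V.Nonempty) :
    ncSum (cum m) V = m V := by
  classical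
  have h := ncSum_sub_ncSum (f := cum m) (g := fun W => if W ⊂ V then cum m W else 0) hV
    fun W hW _ => (if_pos hW).symm
  have h' : cum m V = m V - ncSum (fun W => if W ⊂ V then cum m W else 0) V := by
    rw [cum]
    simp only [dite_eq_ite]
  simp only [ssubset_irrefl, if_false, sub_zero] at h
  linear_combination h + h'

theorem eq_cum {f m : Finset ι → ℂ} {V : Finset ι} (hV : V.Nonempty)
    (h : ∀ W ⊆ V, W.Nonempty → ncSum f W = m W) : f V = cum m V :=
  eq_of_ncSum_eq V hV fun W hW hWn => (h W hW hWn).trans (ncSum_cum m hWn).symm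

/-- Each partition has exactly one block containing `j`, so the sum is linear in the weights of
those blocks. -/
theorem ncSum_linear_block {f g h : Finset ι → ℂ} {V : Finset ι} {j : ι} (hj : j ∈ V) (s t : ℂ)
    (h₁ : ∀ W ⊆ V, j ∈ W → f W = s * g W + t * h W)
    (h₂ : ∀ W ⊆ V, j ∉ W → W.Nonempty → f W = g W ∧ f W = h W) :
    ncSum f V = s * ncSum g V + t * ncSum h V := by
  rw [ncSum_eq_sum_block f hj, ncSum_eq_sum_block g hj, ncSum_eq_sum_block h hj, Finset.mul_sum,
    Finset.mul_sum, ← Finset.sum_add_distrib]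
  refine Finset.sum_congr rfl fun W hW => ?_
  simp only [Finset.mem_filter, Finset.mem_powerset] at hW
  have hX : ∀ X ⊆ V \ W, X.Nonempty → f X = g X ∧ f X = h X := fun X hX hXn =>
    h₂ X (hX.trans Finset.sdiff_subset) (fun hjX => (Finset.mem_sdiff.1 (hX hjX)).2 hW.2) hXn
  have hg : ncSum (avoiding W g) (V \ W) = ncSum (avoiding W f) (V \ W) :=
    ncSum_congr fun X h h' => by simp only [avoiding, (hX X h h').1]
  have hh : ncSum (avoiding W h) (V \ W) = ncSum (avoiding W f) (V \ W) :=
    ncSum_congr fun X h h' => by simp only [avoiding, ← (hX X h h').2]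
  rw [h₁ W hW.1 hW.2, hg, hh]
  ring

/-- No point of `X` separates `j` from `j'`. If two points of `X` separate a point of `W₁` from a
point of `W₂`, then `j` and `j'` lie on the same side of the separation, so `X` already crosses one
of the two sets. -/
theorem nonCrossing_union_iff {W₁ W₂ X : Finset ι} {j j' : ι} (hj : j ∈ W₁) (hj' : j' ∈ W₂)
    (hX : ∀ x ∈ X, x < j ∧ x < j' ∨ j < x ∧ j' < x) :
    NonCrossing (W₁ ∪ W₂) X ↔ NonCrossing W₁ X ∧ NonCrossing W₂ X := by
  refine ⟨fun h => ⟨h.mono Finset.subset_union_left subset_rfl,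
    h.mono Finset.subset_union_right subset_rfl⟩, fun ⟨h₁, h₂⟩ => ?_⟩
  have side : ∀ (W : Finset ι) (k : ι), k ∈ W → NonCrossing W X → ∀ w ∈ W, ∀ x ∈ X, ∀ y ∈ X,
      x < w → w < y → (k < x ∨ y < k) → False := by
    intro W k hk h w hw x hx y hy hxw hwy hor
    rcases hor with hor | hor
    · exact (h k x w y hor hxw hwy).1 ⟨hk, hw, hx, hy⟩
    · exact (h x w y k hxw hwy hor).2 ⟨hx, hy, hw, hk⟩
  have side' : ∀ (W : Finset ι) (k : ι), k ∈ W → NonCrossing W X → ∀ w ∈ W, ∀ x ∈ X, ∀ y ∈ X,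
      (w < x ∨ y < w) → (x < k ∧ k < y) → False := fun W k hk h w hw x hx y hy hor hk' =>
    side W w hw h k hk x hx y hy hk'.1 hk'.2 hor
  have key : ∀ (W W' : Finset ι) (k k' : ι), k ∈ W → k' ∈ W' → NonCrossing W X →
      NonCrossing W' X → (∀ x ∈ X, x < k ∧ x < k' ∨ k < x ∧ k' < x) →
      ∀ w ∈ W, ∀ w' ∈ W', ∀ x ∈ X, ∀ y ∈ X, x < w → w < y → (w' < x ∨ y < w') → False := by
    intro W W' k k' hk hk' h h' hX w hw w' hw' x hx y hy hxw hwy hor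
    rcases hX x hx with ⟨hxk, hxk'⟩ | ⟨hxk, hxk'⟩
    · rcases hX y hy with ⟨hyk, hyk'⟩ | ⟨hyk, hyk'⟩
      · exact side W k hk h w hw x hx y hy hxw hwy (Or.inr hyk)
      · exact side' W' k' hk' h' w' hw' x hx y hy hor ⟨hxk', hyk'⟩
    · exact side W k hk h w hw x hx y hy hxw hwy (Or.inl hxk)
  have hX' : ∀ x ∈ X, x < j' ∧ x < j ∨ j' < x ∧ j < x := fun x hx =>
    (hX x hx).imp And.symm And.symm
  have all : ∀ w ∈ W₁ ∪ W₂, ∀ w' ∈ W₁ ∪ W₂, ∀ x ∈ X, ∀ y ∈ X, x < w → w < y →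
      (w' < x ∨ y < w') → False := by
    intro w hw w' hw' x hx y hy hxw hwy hor
    rcases Finset.mem_union.1 hw with hw | hw <;> rcases Finset.mem_union.1 hw' with hw' | hw'
    · exact side W₁ w' hw' h₁ w hw x hx y hy hxw hwy hor
    · exact key W₁ W₂ j j' hj hj' h₁ h₂ hX w hw w' hw' x hx y hy hxw hwy hor
    · exact key W₂ W₁ j' j hj' hj h₂ h₁ hX' w hw w' hw' x hx y hy hxw hwy hor
    · exact side W₂ w' hw' h₂ w hw x hx y hy hxw hwy hor
  intro p₁ q₁ p₂ q₂ l₁ l₂ l₃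
  exact ⟨fun ⟨a, b, c, d⟩ => all p₂ b p₁ a q₁ c q₂ d l₂ l₃ (Or.inl l₁),
    fun ⟨a, b, c, d⟩ => all q₁ c q₂ d p₁ a p₂ b l₁ l₂ (Or.inr l₃)⟩

/-- The weight obtained from `f` by merging the element `j'` into `j`. -/
noncomputable def mergeWeight (j j' : ι) (f : Finset ι → ℂ) (U : Finset ι) : ℂ :=
  if j ∈ U then
    f (insert j' U) +
      ∑ W ∈ U.powerset with j ∈ W, f W * avoiding W f (insert j' (U \ W))
  else f U

/-- Merging two neighbouring elements does not change sums over non-crossing partitions. -/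
theorem ncSum_mergeWeight (f : Finset ι → ℂ) {V : Finset ι} {j j' : ι} (hj : j ∈ V)
    (hj' : j' ∈ V) (hjj' : j < j') (hadj : ∀ r ∈ V, ¬(j < r ∧ r < j')) :
    ncSum (mergeWeight j j' f) (V.erase j') = ncSum f V := by
  have hne : j ≠ j' := hjj'.ne
  have side : ∀ X ⊆ V, j ∉ X → j' ∉ X → ∀ x ∈ X, x < j ∧ x < j' ∨ j < x ∧ j' < x := by
    intro X hX hjX hjX' x hx
    rcases lt_trichotomy x j with h | rfl | h
    · exact Or.inl ⟨h, h.trans hjj'⟩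
    · exact absurd hx hjX
    · refine Or.inr ⟨h, ?_⟩
      rcases lt_trichotomy x j' with h' | rfl | h'
      · exact absurd ⟨h, h'⟩ (hadj x (hX hx))
      · exact absurd hx hjX'
      · exact h'
  have ins : ∀ U X : Finset ι, j ∈ U → X ⊆ V → j ∉ X → j' ∉ X →
      (NonCrossing (insert j' U) X ↔ NonCrossing U X) := by
    intro U X hjU hX hjX hjX'
    rw [Finset.insert_eq, Finset.union_comm,
      nonCrossing_union_iff hjU (Finset.mem_singleton_self j') (side X hX hjX hjX')]
    exact and_iff_left (nonCrossing_singleton j' X)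
  have hjV : j ∈ V.erase j' := Finset.mem_erase.2 ⟨hne, hj⟩
  -- Once the block of `j` is removed, the other blocks miss `j`, where `mergeWeight` is just `f`.
  have rest : ∀ U ⊆ V.erase j', j ∈ U →
      ncSum (avoiding U (mergeWeight j j' f)) (V.erase j' \ U) =
        ncSum (avoiding U f) (V.erase j' \ U) := by
    intro U _ hjU
    refine ncSum_congr fun X hX _ => ?_
    have : j ∉ X := fun h => (Finset.mem_sdiff.1 (hX h)).2 hjU
    simp only [avoiding, mergeWeight, if_neg this]
  rw [ncSum_eq_sum_block _ hjV, ncSum_eq_sum_block f hj,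
    ← Finset.sum_filter_add_sum_filter_not (V.powerset.filter fun W => j ∈ W) fun W => j' ∈ W]
  have hL : ∑ U ∈ (V.erase j').powerset with j ∈ U,
        mergeWeight j j' f U * ncSum (avoiding U (mergeWeight j j' f)) (V.erase j' \ U) =
      (∑ U ∈ (V.erase j').powerset with j ∈ U,
        f (insert j' U) * ncSum (avoiding U f) (V.erase j' \ U)) +
      ∑ U ∈ (V.erase j').powerset with j ∈ U, ∑ W ∈ U.powerset with j ∈ W,
        f W * avoiding W f (insert j' (U \ W)) * ncSum (avoiding U f) (V.erase j' \ U) := by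
    rw [← Finset.sum_add_distrib]
    refine Finset.sum_congr rfl fun U hU => ?_
    simp only [Finset.mem_filter, Finset.mem_powerset] at hU
    rw [rest U hU.1 hU.2, mergeWeight, if_pos hU.2, add_mul, Finset.sum_mul]
  rw [hL]
  congr 1
  -- Partitions of `V` with `j` and `j'` in the same block.
  · refine Finset.sum_bij' (fun U _ => insert j' U) (fun W _ => W.erase j') ?_ ?_ ?_ ?_ ?_
    · intro U hU
      simp only [Finset.mem_filter, Finset.mem_powerset] at hU ⊢
      exact ⟨⟨Finset.insert_subset hj' (hU.1.trans (Finset.erase_subset _ _)),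
        Finset.mem_insert_of_mem hU.2⟩, Finset.mem_insert_self _ _⟩
    · intro W hW
      simp only [Finset.mem_filter, Finset.mem_powerset] at hW ⊢
      exact ⟨Finset.erase_subset_erase _ hW.1.1, Finset.mem_erase.2 ⟨hne, hW.1.2⟩⟩
    · intro U hU
      simp only [Finset.mem_filter, Finset.mem_powerset] at hU
      exact Finset.erase_insert fun h => Finset.notMem_erase _ _ (hU.1 h)
    · intro W hW
      exact Finset.insert_erase (Finset.mem_filter.1 hW).2
    · intro U hU
      simp only [Finset.mem_filter, Finset.mem_powerset] at hU
      have hs : V.erase j' \ U = V \ insert j' U := by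
        ext x
        simp only [Finset.mem_sdiff, Finset.mem_erase, Finset.mem_insert]
        tauto
      rw [hs]
      congr 1
      refine ncSum_congr fun X hX _ => ?_
      rw [Finset.subset_sdiff] at hX
      have h₁ : j ∉ X := fun h =>
        Finset.disjoint_left.1 hX.2 h (Finset.mem_insert_of_mem hU.2)
      have h₂ : j' ∉ X := fun h => Finset.disjoint_left.1 hX.2 h (Finset.mem_insert_self _ _)
      exact avoiding_congr (ins U X hU.2 hX.1 h₁ h₂).symm rfl
  -- Partitions with distinct blocks `W ∋ j` and `X ∋ j'`: these fuse into `U = W ∪ X.erase j'`, and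
  -- `X` is recovered as `insert j' (U \ W)`.
  · have hR : ∑ W ∈ (V.powerset.filter fun W => j ∈ W) with j' ∉ W,
          f W * ncSum (avoiding W f) (V \ W) =
        ∑ W ∈ (V.powerset.filter fun W => j ∈ W) with j' ∉ W,
          ∑ X ∈ (V \ W).powerset with j' ∈ X,
            f W * avoiding W f X * ncSum (avoiding X (avoiding W f)) ((V \ W) \ X) := by
      refine Finset.sum_congr rfl fun W hW => ?_
      simp only [Finset.mem_filter, Finset.mem_powerset] at hW
      rw [ncSum_eq_sum_block _ (Finset.mem_sdiff.2 ⟨hj', hW.2⟩), Finset.mul_sum]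
      exact Finset.sum_congr rfl fun X _ => (mul_assoc _ _ _).symm
    rw [hR, Finset.sum_sigma', Finset.sum_sigma']
    refine Finset.sum_bij' (fun p _ => ⟨p.2, insert j' (p.1 \ p.2)⟩)
      (fun p _ => ⟨p.1 ∪ p.2.erase j', p.1⟩) ?_ ?_ ?_ ?_ ?_
    · rintro ⟨U, W⟩ h
      simp only [Finset.mem_sigma, Finset.mem_filter, Finset.mem_powerset] at h ⊢
      obtain ⟨⟨hU, hjU⟩, hW, hjW⟩ := h
      have hU' := Finset.subset_erase.1 hU
      refine ⟨⟨⟨hW.trans hU'.1, hjW⟩, fun h => hU'.2 (hW h)⟩, ?_, Finset.mem_insert_self _ _⟩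
      exact Finset.insert_subset (Finset.mem_sdiff.2 ⟨hj', fun h => hU'.2 (hW h)⟩)
        (Finset.sdiff_subset_sdiff hU'.1 subset_rfl)
    · rintro ⟨W, X⟩ h
      simp only [Finset.mem_sigma, Finset.mem_filter, Finset.mem_powerset] at h ⊢
      obtain ⟨⟨⟨hW, hjW⟩, hjW'⟩, hX, hjX'⟩ := h
      refine ⟨⟨Finset.union_subset (Finset.subset_erase.2 ⟨hW, hjW'⟩)
        (Finset.erase_subset_erase _ (hX.trans Finset.sdiff_subset)),
        Finset.mem_union_left _ hjW⟩, Finset.subset_union_left, hjW⟩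
    · rintro ⟨U, W⟩ h
      simp only [Finset.mem_sigma, Finset.mem_filter, Finset.mem_powerset] at h
      obtain ⟨⟨hU, hjU⟩, hW, hjW⟩ := h
      have hU' := Finset.subset_erase.1 hU
      have : W ∪ (insert j' (U \ W)).erase j' = U := by
        rw [Finset.erase_insert fun h => hU'.2 (Finset.sdiff_subset h),
          Finset.union_sdiff_of_subset hW]
      simp only [this]
    · rintro ⟨W, X⟩ h
      simp only [Finset.mem_sigma, Finset.mem_filter, Finset.mem_powerset] at h
      obtain ⟨⟨⟨hW, hjW⟩, hjW'⟩, hX, hjX'⟩ := h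
      have : insert j' ((W ∪ X.erase j') \ W) = X := by
        rw [Finset.union_sdiff_cancel_left, Finset.insert_erase hjX']
        exact ((Finset.subset_sdiff.1 hX).2.mono_left (Finset.erase_subset _ _)).symm
      simp only [this]
    · rintro ⟨U, W⟩ h
      simp only [Finset.mem_sigma, Finset.mem_filter, Finset.mem_powerset] at h
      obtain ⟨⟨hU, hjU⟩, hW, hjW⟩ := h
      have hU' := Finset.subset_erase.1 hU
      have hu : W ∪ insert j' (U \ W) = insert j' U := by
        rw [Finset.union_insert, Finset.union_sdiff_of_subset hW]
      have hs : V.erase j' \ U = (V \ W) \ insert j' (U \ W) := by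
        rw [sdiff_sdiff_left, Finset.sup_eq_union, hu]
        ext x
        simp only [Finset.mem_sdiff, Finset.mem_erase, Finset.mem_insert]
        tauto
      simp only
      rw [hs]
      congr 1
      refine ncSum_congr fun X hX _ => ?_
      rw [sdiff_sdiff_left, Finset.sup_eq_union, hu, Finset.subset_sdiff] at hX
      have h₁ : j ∉ X := fun h =>
        Finset.disjoint_left.1 hX.2 h (Finset.mem_insert_of_mem hjU)
      have h₂ : j' ∉ X := fun h => Finset.disjoint_left.1 hX.2 h (Finset.mem_insert_self _ _)
      have h₃ : NonCrossing U X ↔ NonCrossing W X ∧ NonCrossing (insert j' (U \ W)) X := by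
        rw [← ins U X hjU hX.1 h₁ h₂, ← hu]
        exact nonCrossing_union_iff hjW (Finset.mem_insert_self _ _) (side X hX.1 h₁ h₂)
      simp only [avoiding, h₃]
      split_ifs <;> tauto

/-- Each correction term splits `insert j' U` into a part containing `j` and a part containing `j'`.
Were both monochromatic, `c j = c j'` would make `U` monochromatic; so one factor is mixed and
vanishes. -/
theorem mergeWeight_eq_of_mixed {I : Type*} (c : ι → I) {f : Finset ι → ℂ} {U : Finset ι}
    {j j' : ι} (hj : j ∈ U) (hj' : j' ∉ U) (hc : c j = c j') (hmix : ∃ l ∈ U, ∃ k ∈ U, c l ≠ c k)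
    (h : ∀ W ⊂ insert j' U, (∃ l ∈ W, ∃ k ∈ W, c l ≠ c k) → f W = 0) :
    mergeWeight j j' f U = f (insert j' U) := by
  obtain ⟨l, hl, k, hk, hlk⟩ := hmix
  rw [mergeWeight, if_pos hj, add_eq_left]
  refine Finset.sum_eq_zero fun W hW => ?_
  simp only [Finset.mem_filter, Finset.mem_powerset] at hW
  by_cases h₁ : ∃ l ∈ W, ∃ k ∈ W, c l ≠ c k
  · rw [h W (hW.1.trans_ssubset (Finset.ssubset_insert hj')) h₁, zero_mul]
  · have h₂ : ∃ l ∈ insert j' (U \ W), ∃ k ∈ insert j' (U \ W), c l ≠ c k := by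
      by_contra! h₂
      push Not at h₁
      have h₃ : ∀ x ∈ U, c x = c j := by
        intro x hx
        by_cases hxW : x ∈ W
        · exact h₁ x hxW j hW.2
        · rw [hc]
          exact h₂ x (Finset.mem_insert_of_mem (Finset.mem_sdiff.2 ⟨hx, hxW⟩)) j'
            (Finset.mem_insert_self _ _)
      exact hlk ((h₃ l hl).trans (h₃ k hk).symm)
    have hne : j ∉ insert j' (U \ W) := by
      simp only [Finset.mem_insert, Finset.mem_sdiff, not_or, not_and, not_not]
      exact ⟨fun h => hj' (h ▸ hj), fun _ => hW.2⟩
    have h₃ := h (insert j' (U \ W))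
      ((Finset.ssubset_iff_of_subset (Finset.insert_subset_insert j' Finset.sdiff_subset)).2
        ⟨j, Finset.mem_insert_of_mem hj, hne⟩) h₂
    simp [avoiding, h₃]

end Cum

/-! ### Moments and cumulants of words -/

section Words

variable {A : Type*} [Ring A] {ι : Type*} [LinearOrder ι]

/-- The product of the letters of `a` with indices in `V`, in increasing order. -/
noncomputable def word (a : ι → A) (V : Finset ι) : A :=
  ((V.sort (· ≤ ·)).map a).prod

@[simp]
theorem word_empty (a : ι → A) : word a ∅ = 1 := by
  simp [word]

@[simp]
theorem word_singleton (a : ι → A) (j : ι) : word a {j} = a j := by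
  simp [word]

theorem word_congr {a b : ι → A} {V : Finset ι} (h : ∀ j ∈ V, a j = b j) :
    word a V = word b V := by
  unfold word
  congr 1
  exact List.map_congr_left fun j hj => h j ((Finset.mem_sort _).1 hj)

theorem word_union (a : ι → A) {U V : Finset ι} (h : ∀ x ∈ U, ∀ y ∈ V, x < y) :
    word a (U ∪ V) = word a U * word a V := by
  have hd : Disjoint U V := Finset.disjoint_left.2 fun x hx hx' => lt_irrefl x (h x hx x hx')
  have hs : (U ∪ V).sort (· ≤ ·) = U.sort (· ≤ ·) ++ V.sort (· ≤ ·) := by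
    refine List.Perm.eq_of_pairwise (le := (· ≤ ·)) (fun x y _ _ => le_antisymm)
      (Finset.pairwise_sort _ _) ?_ ?_
    · rw [List.pairwise_append]
      refine ⟨Finset.pairwise_sort _ _, Finset.pairwise_sort _ _, fun x hx y hy => ?_⟩
      rw [Finset.mem_sort] at hx hy
      exact (h x hx y hy).le
    · rw [List.perm_ext_iff_of_nodup (Finset.sort_nodup _ _)]
      · simp
      · rw [List.nodup_append]
        refine ⟨Finset.sort_nodup _ _, Finset.sort_nodup _ _, fun x hx y hy => ?_⟩
        rw [Finset.mem_sort] at hx hy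
        exact (h x hx y hy).ne
  rw [word, hs, List.map_append, List.prod_append, word, word]

theorem word_map {κ : Type*} [LinearOrder κ] (e : κ ↪o ι) (a : ι → A) (V : Finset κ) :
    word a (V.map e.toEmbedding) = word (fun j => a (e j)) V := by
  have hs : (V.map e.toEmbedding).sort (· ≤ ·) = (V.sort (· ≤ ·)).map e := by
    refine List.Perm.eq_of_pairwise (le := (· ≤ ·)) (fun x y _ _ => le_antisymm)
      (Finset.pairwise_sort _ _) ?_ ?_
    · rw [List.pairwise_map]
      exact (Finset.pairwise_sort V (· ≤ ·)).imp fun h => e.monotone h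
    · rw [List.perm_ext_iff_of_nodup (Finset.sort_nodup _ _)]
      · simp
      · exact (Finset.sort_nodup _ _).map e.injective
  rw [word, hs, List.map_map]
  rfl

theorem word_split (a : ι → A) {V : Finset ι} {j : ι} (hj : j ∈ V) :
    word a V = word a (V.filter (· < j)) * a j * word a (V.filter (j < ·)) := by
  have h : V = (V.filter (· < j) ∪ {j}) ∪ V.filter (j < ·) := by
    ext x
    simp only [Finset.mem_union, Finset.mem_filter, Finset.mem_singleton]
    constructor
    · intro hx
      rcases lt_trichotomy x j with h | h | h <;> tauto
    · rintro ((h | rfl) | h) <;> tauto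
  conv_lhs => rw [h]
  rw [word_union, word_union, word_singleton]
  · intro x hx y hy
    simp only [Finset.mem_filter, Finset.mem_singleton] at hx hy
    exact hy ▸ hx.2
  · intro x hx y hy
    simp only [Finset.mem_union, Finset.mem_filter, Finset.mem_singleton] at hx hy
    rcases hx with hx | rfl
    · exact hx.2.trans hy.2
    · exact hy.2

theorem word_erase_of_eq_one {a : ι → A} {V : Finset ι} {j : ι} (hj : j ∈ V) (h : a j = 1) :
    word a (V.erase j) = word a V := by
  have h' : V.erase j = V.filter (· < j) ∪ V.filter (j < ·) := by
    ext x
    simp only [Finset.mem_union, Finset.mem_filter, Finset.mem_erase, ne_iff_lt_or_gt]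
    tauto
  rw [word_split a hj, h', word_union, h, mul_one]
  intro x hx y hy
  exact (Finset.mem_filter.1 hx).2.trans (Finset.mem_filter.1 hy).2

/-- The word in which the letter `j'` is multiplied into the letter `j`. -/
def mergeLetters (a : ι → A) (j j' : ι) : ι → A :=
  Function.update a j (a j * a j')

theorem word_mergeLetters (a : ι → A) {V : Finset ι} {j j' : ι} (hj : j ∈ V) (hj' : j' ∈ V)
    (hjj' : j < j') (hadj : ∀ r ∈ V, ¬(j < r ∧ r < j')) :
    word (mergeLetters a j j') (V.erase j') = word a V := by
  have h₁ : j ∈ V.erase j' := Finset.mem_erase.2 ⟨hjj'.ne, hj⟩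
  have h₂ : j' ∈ V.filter (j < ·) := Finset.mem_filter.2 ⟨hj', hjj'⟩
  rw [word_split _ h₁, word_split a hj, word_split a h₂]
  have e₁ : (V.erase j').filter (· < j) = V.filter (· < j) := by
    ext x
    simp only [Finset.mem_filter, Finset.mem_erase]
    exact ⟨fun h => ⟨h.1.2, h.2⟩, fun h => ⟨⟨(h.2.trans hjj').ne, h.1⟩, h.2⟩⟩
  have e₂ : (V.filter (j < ·)).filter (· < j') = ∅ := by
    ext x
    simp only [Finset.mem_filter, Finset.notMem_empty, iff_false]
    exact fun h => hadj x h.1.1 ⟨h.1.2, h.2⟩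
  have e₃ : (V.erase j').filter (j < ·) = (V.filter (j < ·)).filter (j' < ·) := by
    ext x
    simp only [Finset.mem_filter, Finset.mem_erase]
    constructor
    · rintro ⟨⟨h, hx⟩, hjx⟩
      refine ⟨⟨hx, hjx⟩, lt_of_le_of_ne (not_lt.1 fun h' => hadj x hx ⟨hjx, h'⟩) h.symm⟩
    · rintro ⟨⟨hx, hjx⟩, h⟩
      exact ⟨⟨h.ne', hx⟩, hjx⟩
  have e₄ : word (mergeLetters a j j') (V.filter (· < j)) = word a (V.filter (· < j)) :=
    word_congr fun x hx => Function.update_of_ne (Finset.mem_filter.1 hx).2.ne _ _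
  have e₅ : word (mergeLetters a j j') ((V.filter (j < ·)).filter (j' < ·)) =
      word a ((V.filter (j < ·)).filter (j' < ·)) :=
    word_congr fun x hx => Function.update_of_ne
      (hjj'.trans (Finset.mem_filter.1 hx).2).ne' _ _
  rw [e₁, e₂, e₃, e₄, e₅, word_empty, one_mul, mergeLetters, Function.update_self]
  simp only [mul_assoc]

variable [Algebra ℂ A]

/-- The free cumulant of the letters of `a` with indices in `V`. -/
noncomputable def cumulant (φ : A →ₗ[ℂ] ℂ) (a : ι → A) : Finset ι → ℂ :=
  cum fun V => φ (word a V)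

theorem ncSum_cumulant {φ : A →ₗ[ℂ] ℂ} (hφ : φ 1 = 1) (a : ι → A) (V : Finset ι) :
    ncSum (cumulant φ a) V = φ (word a V) := by
  rcases V.eq_empty_or_nonempty with rfl | hV
  · simp [hφ]
  · exact ncSum_cum _ hV

theorem eq_cumulant {φ : A →ₗ[ℂ] ℂ} {a : ι → A} {f : Finset ι → ℂ} {V : Finset ι}
    (hV : V.Nonempty) (h : ∀ W ⊆ V, W.Nonempty → ncSum f W = φ (word a W)) :
    f V = cumulant φ a V :=
  eq_cum hV h

variable {φ : A →ₗ[ℂ] ℂ} (hφ : φ 1 = 1)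
include hφ

theorem cumulant_congr {a b : ι → A} {V : Finset ι} (hV : V.Nonempty)
    (h : ∀ j ∈ V, a j = b j) : cumulant φ a V = cumulant φ b V :=
  eq_cumulant hV fun W hW _ => by
    rw [ncSum_cumulant hφ, word_congr fun j hj => h j (hW hj)]

theorem cumulant_map {κ : Type*} [LinearOrder κ] (e : κ ↪o ι) (a : ι → A) {V : Finset κ}
    (hV : V.Nonempty) :
    cumulant φ a (V.map e.toEmbedding) = cumulant φ (fun j => a (e j)) V :=
  eq_cumulant (f := fun W => cumulant φ a (W.map e.toEmbedding)) hV fun W _ _ => by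
    rw [ncSum_map, ncSum_cumulant hφ, word_map]

theorem cumulant_singleton (a : ι → A) (j : ι) : cumulant φ a {j} = φ (a j) := by
  have h := ncSum_cumulant hφ a {j}
  rw [ncSum_eq_sum_block _ (Finset.mem_singleton_self j), Finset.sum_eq_single {j}] at h
  · simpa using h
  · intro W hW hne
    simp only [Finset.mem_filter, Finset.mem_powerset, Finset.subset_singleton_iff] at hW
    rcases hW.1 with rfl | h
    · simp at hW
    · exact absurd h hne
  · simp

/-- Cumulants of length at least two with an entry `1` vanish. -/
theorem cumulant_eq_zero_of_one {a : ι → A} {V : Finset ι} {j : ι} (hj : j ∈ V) (ha : a j = 1)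
    (hV : V ≠ {j}) : cumulant φ a V = 0 := by
  -- This weight forces `j` to be a singleton block of weight `1`, so its sums are the moments of
  -- the word without the letter `a j = 1`.
  let f : Finset ι → ℂ := fun W => if j ∈ W then (if W = {j} then 1 else 0) else cumulant φ a W
  have hf : f V = 0 := by simp [f, hj, hV]
  rw [← hf]
  refine (eq_cumulant ⟨j, hj⟩ fun W _ _ => ?_).symm
  have hcongr : ∀ U : Finset ι, j ∉ U → ncSum f U = φ (word a U) := by
    intro U hU
    rw [← ncSum_cumulant hφ]
    exact ncSum_congr fun X hX _ => if_neg fun h => hU (hX h)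
  by_cases hjW : j ∈ W
  · rw [ncSum_eq_sum_block f hjW, Finset.sum_eq_single {j}]
    · have h₁ : ncSum (avoiding {j} f) (W \ {j}) = ncSum f (W \ {j}) :=
        ncSum_congr fun X _ _ => if_pos (nonCrossing_singleton j X)
      rw [h₁, hcongr _ (by simp), Finset.sdiff_singleton_eq_erase, word_erase_of_eq_one hjW ha]
      simp [f]
    · intro X hX hne
      simp only [Finset.mem_filter] at hX
      simp [f, hX.2, hne]
    · simp [hjW]
  · exact hcongr W hjW

theorem cumulant_update_linear (a : ι → A) {V : Finset ι} {j : ι} (hj : j ∈ V) (s t : ℂ)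
    (x y : A) :
    cumulant φ (Function.update a j (s • x + t • y)) V =
      s * cumulant φ (Function.update a j x) V + t * cumulant φ (Function.update a j y) V := by
  let g := cumulant φ (Function.update a j x)
  let h := cumulant φ (Function.update a j y)
  let f : Finset ι → ℂ := fun W => if j ∈ W then s * g W + t * h W else g W
  have hf : f V = s * g V + t * h V := if_pos hj
  change _ = s * g V + t * h V
  rw [← hf]
  refine (eq_cumulant ⟨j, hj⟩ fun W _ _ => ?_).symm
  have hup : ∀ (z z' : A) (U : Finset ι), j ∉ U → ∀ i ∈ U,
      Function.update a j z i = Function.update a j z' i := by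
    intro z z' U hU i hi
    have : i ≠ j := fun h => hU (h ▸ hi)
    rw [Function.update_of_ne this, Function.update_of_ne this]
  by_cases hjW : j ∈ W
  · rw [ncSum_linear_block (g := g) (h := h) hjW s t, ncSum_cumulant hφ, ncSum_cumulant hφ]
    · have hw : ∀ z, word (Function.update a j z) W =
          word a (W.filter (· < j)) * z * word a (W.filter (j < ·)) := by
        intro z
        rw [word_split _ hjW, Function.update_self]
        congr 1
        · congr 1
          exact word_congr fun i hi => Function.update_of_ne (Finset.mem_filter.1 hi).2.ne _ _
        · exact word_congr fun i hi => Function.update_of_ne (Finset.mem_filter.1 hi).2.ne' _ _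
      rw [hw, hw, hw, mul_add, add_mul, map_add]
      simp
    · intro U _ hjU
      exact if_pos hjU
    · intro U _ hjU hU
      refine ⟨if_neg hjU, (if_neg hjU).trans ?_⟩
      exact cumulant_congr hφ hU (hup x y U hjU)
  · have h₁ : ncSum f W = ncSum g W :=
      ncSum_congr fun U hU _ => if_neg fun h => hjW (hU h)
    rw [h₁, ncSum_cumulant hφ, word_congr (hup _ _ W hjW)]

/-- The formula for cumulants with products as entries, for one product of two letters: by
`ncSum_mergeWeight` the merged weight has the moments of the merged word as its sums. Sets `U` avoid
`j'`, whose letter `mergeLetters` leaves in place. -/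
theorem cumulant_mergeLetters (a : ι → A) {V : Finset ι} {j j' : ι} (hj : j ∈ V) (hj' : j' ∈ V)
    (hjj' : j < j') (hadj : ∀ r ∈ V, ¬(j < r ∧ r < j')) {U : Finset ι} (hU : U ⊆ V.erase j')
    (hUn : U.Nonempty) :
    cumulant φ (mergeLetters a j j') U = mergeWeight j j' (cumulant φ a) U := by
  refine (eq_cumulant hUn fun W hW _ => ?_).symm
  have hW' := Finset.subset_erase.1 (hW.trans hU)
  by_cases hjW : j ∈ W
  · have h₁ : (insert j' W).erase j' = W := Finset.erase_insert hW'.2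
    have h₂ : ∀ r ∈ insert j' W, ¬(j < r ∧ r < j') := fun r hr =>
      hadj r (Finset.insert_subset hj' hW'.1 hr)
    have h₃ := ncSum_mergeWeight (cumulant φ a) (Finset.mem_insert_of_mem hjW)
      (Finset.mem_insert_self j' W) hjj' h₂
    have h₄ := word_mergeLetters a (Finset.mem_insert_of_mem hjW)
      (Finset.mem_insert_self j' W) hjj' h₂
    rw [h₁] at h₃ h₄
    rw [h₃, h₄, ncSum_cumulant hφ]
  · have h₁ : ncSum (mergeWeight j j' (cumulant φ a)) W = ncSum (cumulant φ a) W :=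
      ncSum_congr fun X hX _ => if_neg fun h => hjW (hX h)
    rw [h₁, ncSum_cumulant hφ]
    congr 1
    refine word_congr fun i hi => (Function.update_of_ne ?_ _ _).symm
    rintro rfl
    exact hjW hi

/-- Merging neighbouring letters of the same colour preserves the vanishing of mixed cumulants. -/
theorem mixed_cumulant_mergeLetters {I : Type*} (c : ι → I) (a : ι → A) {V : Finset ι} {j j' : ι}
    (hj : j ∈ V) (hj' : j' ∈ V) (hjj' : j < j') (hadj : ∀ r ∈ V, ¬(j < r ∧ r < j'))
    (hc : c j = c j') {U : Finset ι} (hU : U ⊆ V.erase j') (hmix : ∃ l ∈ U, ∃ k ∈ U, c l ≠ c k)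
    (h : ∀ W ⊆ insert j' U, (∃ l ∈ W, ∃ k ∈ W, c l ≠ c k) → cumulant φ a W = 0) :
    cumulant φ (mergeLetters a j j') U = 0 := by
  obtain ⟨l, hl, k, hk, hlk⟩ := hmix
  have hU' := Finset.subset_erase.1 hU
  rw [cumulant_mergeLetters hφ a hj hj' hjj' hadj hU ⟨l, hl⟩]
  by_cases hjU : j ∈ U
  · rw [mergeWeight_eq_of_mixed c hjU hU'.2 hc ⟨l, hl, k, hk, hlk⟩ fun W hW => h W hW.subset]
    exact h _ subset_rfl
      ⟨l, Finset.mem_insert_of_mem hl, k, Finset.mem_insert_of_mem hk, hlk⟩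
  · rw [mergeWeight, if_neg hjU]
    exact h U (Finset.subset_insert _ _) ⟨l, hl, k, hk, hlk⟩

end Words

/-! ### Comparison with `NC n` and Möbius inversion -/

section FinPartitions

theorem sameBlock_iff {n : ℕ} (π : Finpartition (Finset.univ : Finset (Fin n))) {p q : Fin n}
    {V : Finset (Fin n)} (hV : V ∈ π.parts) (hp : p ∈ V) : SameBlock π p q ↔ q ∈ V := by
  constructor
  · rintro ⟨W, hW, hpW, hqW⟩
    rwa [π.eq_of_mem_parts hV hW hp hpW]
  · exact fun hq => ⟨V, hV, hp, hq⟩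

theorem isNCPartition_parts {n : ℕ} (π : NC n) : IsNCPartition Finset.univ π.1.parts where
  nonempty _ hW := π.1.nonempty_of_mem_parts hW
  subset _ _ := Finset.subset_univ _
  cover x _ := π.1.exists_mem (Finset.mem_univ x)
  disjoint _ hW _ hX h := π.1.disjoint hW hX h
  nonCrossing W hW X hX h := by
    have hd : ∀ x ∈ W, x ∈ X → False := fun x hx hx' =>
      Finset.disjoint_left.1 (π.1.disjoint hW hX h) hx hx'
    intro p₁ q₁ p₂ q₂ h₁ h₂ h₃
    constructor
    · rintro ⟨a, b, c, d⟩
      refine π.2 ⟨p₁, q₁, p₂, q₂, h₁, h₂, h₃, ⟨W, hW, a, b⟩, ⟨X, hX, c, d⟩, ?_⟩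
      rw [sameBlock_iff π.1 hW a]
      exact fun h => hd _ h c
    · rintro ⟨a, b, c, d⟩
      refine π.2 ⟨p₁, q₁, p₂, q₂, h₁, h₂, h₃, ⟨X, hX, a, b⟩, ⟨W, hW, c, d⟩, ?_⟩
      rw [sameBlock_iff π.1 hX a]
      exact fun h => hd _ c h

theorem IsNCPartition.exists_NC {n : ℕ} {P : Finset (Finset (Fin n))}
    (h : IsNCPartition Finset.univ P) : ∃ π : NC n, π.1.parts = P := by
  let π : Finpartition (Finset.univ : Finset (Fin n)) :=
    { parts := P
      supIndep := by
        rw [Finset.supIndep_iff_pairwiseDisjoint]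
        exact fun W hW X hX hne => h.disjoint W hW X hX hne
      sup_parts := by
        ext x
        simpa [Finset.mem_sup] using h.cover x (Finset.mem_univ x)
      bot_notMem := fun hb => Finset.not_nonempty_empty (h.nonempty _ hb) }
  refine ⟨⟨π, ?_⟩, rfl⟩
  rintro ⟨p₁, q₁, p₂, q₂, h₁, h₂, h₃, ⟨W, hW, a, b⟩, ⟨X, hX, c, d⟩, hn⟩
  rw [sameBlock_iff π hW a] at hn
  have hne : W ≠ X := by
    rintro rfl
    exact hn c
  exact (h.nonCrossing W hW X hX hne p₁ q₁ p₂ q₂ h₁ h₂ h₃).1 ⟨a, b, c, d⟩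

theorem sum_NC_eq_ncSum {n : ℕ} (f : Finset (Fin n) → ℂ) :
    ∑ π : NC n, ∏ V ∈ π.1.parts, f V = ncSum f Finset.univ := by
  refine Finset.sum_bij (fun π _ => π.1.parts) ?_ ?_ ?_ ?_
  · exact fun π _ => mem_ncPartitions.2 (isNCPartition_parts π)
  · exact fun π _ σ _ h => Subtype.ext (Finpartition.ext h)
  · intro P hP
    obtain ⟨π, hπ⟩ := (mem_ncPartitions.1 hP).exists_NC
    exact ⟨π, Finset.mem_univ _, hπ⟩
  · exact fun π _ => rfl

-- A non-crossing partition below `σ` is an independent choice of one on each block of `σ`, since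
-- subsets of distinct blocks of `σ` cannot cross.
open scoped Classical in
theorem sum_le_NC_eq_prod_ncSum {n : ℕ} (f : Finset (Fin n) → ℂ) (σ : NC n) :
    ∑ π : NC n with π ≤ σ, ∏ V ∈ π.1.parts, f V = ∏ V ∈ σ.1.parts, ncSum f V := by
  let g : Finset (Fin n) → ℂ := fun W => if ∃ X ∈ σ.1.parts, W ⊆ X then f W else 0
  have h₁ : ∑ π : NC n with π ≤ σ, ∏ V ∈ π.1.parts, f V = ncSum g Finset.univ := by
    rw [← sum_NC_eq_ncSum, Finset.sum_filter]
    refine Finset.sum_congr rfl fun π _ => ?_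
    split_ifs with h
    · exact Finset.prod_congr rfl fun V hV => (if_pos (h hV)).symm
    · have : ∃ V ∈ π.1.parts, ¬∃ X ∈ σ.1.parts, V ⊆ X := by
        by_contra! hcon
        exact h fun V hV => hcon V hV
      obtain ⟨V, hV, hn⟩ := this
      exact (Finset.prod_eq_zero hV (if_neg hn)).symm
  have h₂ : ∀ S ⊆ σ.1.parts, ncSum g (S.sup id) = ∏ V ∈ S, ncSum f V := by
    intro S
    induction S using Finset.induction_on with
    | empty => simp
    | insert V S hVS ih =>
      intro hS
      have hV : V ∈ σ.1.parts := hS (Finset.mem_insert_self _ _)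
      have hS' : S ⊆ σ.1.parts := (Finset.subset_insert _ _).trans hS
      have hdis : ∀ x ∈ V, ∀ X ∈ σ.1.parts, x ∈ X → X = V := fun x hx X hX hxX =>
        σ.1.eq_of_mem_parts hX hV hxX hx
      have hnot : ∀ x ∈ V, x ∈ S.sup id → False := by
        intro x hx hxS
        obtain ⟨X, hX, hxX⟩ := Finset.mem_sup.1 hxS
        exact hVS (hdis x hx X (hS' hX) hxX ▸ hX)
      rw [Finset.sup_insert, Finset.prod_insert hVS, ← ih hS', id, Finset.sup_eq_union,
        ncSum_union]
      · congr 1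
        exact ncSum_congr fun W hW _ => if_pos ⟨V, hV, hW⟩
      · exact Finset.disjoint_left.2 hnot
      · intro W _ x hx y hy hxV hyS
        refine if_neg ?_
        rintro ⟨X, hX, hWX⟩
        exact hnot y (hdis x hxV X hX (hWX hx) ▸ hWX hy) hyS
      · intro W hW X hX _ hgX
        rcases X.eq_empty_or_nonempty with rfl | ⟨x, hx⟩
        · intro p₁ q₁ p₂ q₂ _ _ _
          simp
        have : ∃ Y ∈ σ.1.parts, X ⊆ Y := by
          by_contra hcon
          exact hgX (if_neg hcon)
        obtain ⟨Y, hY, hXY⟩ := this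
        have hne : V ≠ Y := by
          rintro rfl
          exact hnot x (hXY hx) (hX hx)
        exact ((isNCPartition_parts σ).nonCrossing V hV Y hY hne).mono hW hXY
  rw [h₁, ← h₂ _ subset_rfl, σ.1.sup_parts]

variable {A : Type*} [Ring A] [Algebra ℂ A]

theorem momentOn_eq_word (φ : A →ₗ[ℂ] ℂ) {n : ℕ} (a : Fin n → A) (V : Finset (Fin n)) :
    momentOn φ a V = φ (word a V) := by
  rw [momentOn, moment, word, ← Finset.listMap_orderEmbOfFin_finRange V rfl, List.ofFn_eq_map,
    List.map_map]
  rfl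

theorem moment_eq_word (φ : A →ₗ[ℂ] ℂ) {n : ℕ} (a : Fin n → A) :
    φ (List.ofFn a).prod = φ (word a Finset.univ) := by
  rw [word, Fin.sort_univ, List.ofFn_eq_map]

theorem le_NC_one {n : ℕ} (π : NC n) : π ≤ NC.one n :=
  show π.1 ≤ ⊤ from le_top

/-- The free cumulants defined by Möbius inversion solve the moment-cumulant relations. -/
theorem freeCumulant_eq_cumulant {φ : A →ₗ[ℂ] ℂ} (hφ : φ 1 = 1) {n : ℕ} (hn : n ≠ 0)
    (a : Fin n → A) : freeCumulant φ a = cumulant φ a Finset.univ := by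
  classical
  have hm : ∀ π : NC n, momentNC φ π a =
      ∑ ρ : NC n with ρ ≤ π, ∏ V ∈ ρ.1.parts, cumulant φ a V := by
    intro π
    rw [sum_le_NC_eq_prod_ncSum]
    exact Finset.prod_congr rfl fun V _ => by rw [momentOn_eq_word, ncSum_cumulant hφ]
  -- After exchanging the sums, the inner sum of `μ` over an interval is `1` for `ρ = 1_n` and `0`
  -- otherwise.
  have h₁ : freeCumulant φ a = ∑ ρ : NC n, (∏ V ∈ ρ.1.parts, cumulant φ a V) *
      ∑ π ∈ Finset.Icc ρ (NC.one n), IncidenceAlgebra.mu ℂ π (NC.one n) := by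
    have h₂ : freeCumulant φ a = ∑ π : NC n, ∑ ρ : NC n, if ρ ≤ π then
        (∏ V ∈ ρ.1.parts, cumulant φ a V) * IncidenceAlgebra.mu ℂ π (NC.one n) else 0 := by
      rw [freeCumulant, cumulantNC, Finset.filter_true_of_mem fun π _ => le_NC_one π]
      refine Finset.sum_congr rfl fun π _ => ?_
      rw [hm, Finset.sum_mul, Finset.sum_filter]
    rw [h₂, Finset.sum_comm]
    refine Finset.sum_congr rfl fun ρ _ => ?_
    rw [← Finset.sum_filter, Finset.mul_sum]
    refine Finset.sum_congr ?_ fun _ _ => rfl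
    ext π
    simp [le_NC_one]
  rw [h₁, Finset.sum_eq_single (NC.one n)]
  · rw [IncidenceAlgebra.sum_Icc_mu_left, if_pos rfl, mul_one]
    have hp : (NC.one n).1.parts = {Finset.univ} := by
      have : (Finset.univ : Finset (Fin n)) ≠ ⊥ := by
        have := Fin.pos_iff_nonempty.1 (Nat.pos_of_ne_zero hn)
        exact Finset.univ_nonempty.ne_empty
      exact Finset.eq_singleton_iff_nonempty_unique_mem.2
        ⟨Finpartition.parts_nonempty _ this, fun V hV =>
          Finset.mem_singleton.1 (Finpartition.parts_top_subset _ hV)⟩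
    rw [hp, Finset.prod_singleton]
  · intro ρ _ hρ
    rw [IncidenceAlgebra.sum_Icc_mu_left, if_neg hρ, mul_zero]
  · exact fun h => absurd (Finset.mem_univ _) h

theorem cumulant_eq_freeCumulant {ι : Type*} [LinearOrder ι] {φ : A →ₗ[ℂ] ℂ} (hφ : φ 1 = 1)
    (a : ι → A) {V : Finset ι} (hV : V.Nonempty) :
    cumulant φ a V = freeCumulant φ fun j => a (V.orderEmbOfFin rfl j) := by
  rw [freeCumulant_eq_cumulant hφ hV.card_ne_zero, ← cumulant_map hφ (V.orderEmbOfFin rfl) a,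
    Finset.map_orderEmbOfFin_univ]
  have := Fin.pos_iff_nonempty.1 hV.card_pos
  exact Finset.univ_nonempty

end FinPartitions

/-! ### Freeness and vanishing of mixed cumulants -/

section Main

variable {A : Type*} [Ring A] [Algebra ℂ A] {φ : A →ₗ[ℂ] ℂ} {I : Type*}

theorem IsFree.map_word_eq_zero {𝒜 : I → Subalgebra ℂ A} (h : IsFree φ 𝒜) {ι : Type*}
    [LinearOrder ι] (c : ι → I) (a : ι → A) {V : Finset ι} (hV : V.Nonempty)
    (ha : ∀ j ∈ V, a j ∈ 𝒜 (c j)) (h₀ : ∀ j ∈ V, φ (a j) = 0)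
    (hc : ∀ p ∈ V, ∀ q ∈ V, p < q → (∀ r ∈ V, ¬(p < r ∧ r < q)) → c p ≠ c q) :
    φ (word a V) = 0 := by
  let e := V.orderEmbOfFin rfl
  have he : ∀ j, e j ∈ V := Finset.orderEmbOfFin_mem V rfl
  have hw : word a V = word (fun j => a (e j)) Finset.univ := by
    rw [← word_map e a, Finset.map_orderEmbOfFin_univ]
  rw [hw, ← moment_eq_word]
  refine h _ hV.card_pos (fun j => c (e j)) _ (fun j => ha _ (he j)) ?_ fun j => h₀ _ (he j)
  intro j j' hjj'
  refine hc _ (he j) _ (he j') (e.strictMono (Fin.lt_def.2 (by omega))) ?_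
  rintro r hr ⟨h₁, h₂⟩
  obtain ⟨s, rfl⟩ : r ∈ Set.range e := by
    rw [Finset.range_orderEmbOfFin]
    exact hr
  rw [e.lt_iff_lt, Fin.lt_def] at h₁ h₂
  omega

theorem IsFree.cumulant_eq_zero (hφ : φ 1 = 1) {𝒜 : I → Subalgebra ℂ A} (h : IsFree φ 𝒜)
    {ι : Type*} [LinearOrder ι] (c : ι → I) (V : Finset ι) (a : ι → A)
    (ha : ∀ j ∈ V, a j ∈ 𝒜 (c j)) (hmix : ∃ l ∈ V, ∃ k ∈ V, c l ≠ c k) :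
    cumulant φ a V = 0 := by
  induction V using Finset.strongInduction generalizing a with
  | H V ih =>
    have hVn : V.Nonempty := hmix.imp fun l hl => hl.1
    have ih' : ∀ a : ι → A, (∀ j ∈ V, a j ∈ 𝒜 (c j)) → ∀ W ⊂ V,
        (∃ l ∈ W, ∃ k ∈ W, c l ≠ c k) → cumulant φ a W = 0 := fun a ha W hW hm =>
      ih W hW a (fun j hj => ha j (hW.subset hj)) hm
    by_cases hadj : ∃ p ∈ V, ∃ q ∈ V, p < q ∧ (∀ r ∈ V, ¬(p < r ∧ r < q)) ∧ c p = c q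
    · obtain ⟨p, hp, q, hq, hpq, hr, hc⟩ := hadj
      have hpU : p ∈ V.erase q := Finset.mem_erase.2 ⟨hpq.ne, hp⟩
      have hmixU : ∃ l ∈ V.erase q, ∃ k ∈ V.erase q, c l ≠ c k := by
        by_contra! hcon
        have hall : ∀ x ∈ V, c x = c p := by
          intro x hx
          by_cases hxq : x = q
          · rw [hxq, hc]
          · exact hcon x (Finset.mem_erase.2 ⟨hxq, hx⟩) p hpU
        obtain ⟨l, hl, k, hk, hlk⟩ := hmix
        exact hlk ((hall l hl).trans (hall k hk).symm)
      -- The product formula is read backwards: its corrections vanish by induction, so the cumulant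
      -- on `V` equals that of the merged, shorter word.
      have h₁ := cumulant_mergeLetters hφ a hp hq hpq hr subset_rfl ⟨p, hpU⟩
      rw [mergeWeight_eq_of_mixed c hpU (Finset.notMem_erase q V) hc hmixU,
        Finset.insert_erase hq] at h₁
      · rw [← h₁]
        refine ih _ (Finset.erase_ssubset hq) _ (fun j hj => ?_) hmixU
        by_cases hjp : j = p
        · subst hjp
          rw [mergeLetters, Function.update_self]
          exact mul_mem (ha j hp) (hc ▸ ha q hq)
        · rw [mergeLetters, Function.update_of_ne hjp]
          exact ha j (Finset.mem_of_mem_erase hj)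
      · rw [Finset.insert_erase hq]
        exact ih' a ha
    · replace hadj : ∀ p ∈ V, ∀ q ∈ V, p < q → (∀ r ∈ V, ¬(p < r ∧ r < q)) → c p ≠ c q :=
        fun p hp q hq hpq hr hc => hadj ⟨p, hp, q, hq, hpq, hr, hc⟩
      -- `S` contains the positions that may still be uncentred; they are centred one at a time.
      have key : ∀ S ⊆ V, ∀ a : ι → A, (∀ j ∈ V, a j ∈ 𝒜 (c j)) →
          (∀ j ∈ V, j ∉ S → φ (a j) = 0) → cumulant φ a V = 0 := by
        intro S
        induction S using Finset.induction_on with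
        | empty =>
          intro _ a ha h₀
          have h₀' : ∀ j ∈ V, φ (a j) = 0 := fun j hj => h₀ j hj (Finset.notMem_empty j)
          have hw : ncSum (cumulant φ a) V = 0 := by
            rw [ncSum_cumulant hφ]
            exact h.map_word_eq_zero c a hVn ha h₀' hadj
          -- With its value at `V` reset to zero, the weight satisfies the hypotheses of
          -- `ncSum_eq_zero`; the cumulant at `V` is then the moment, which is zero.
          have hf := ncSum_sub_ncSum (f := cumulant φ a)
            (g := fun W => if W = V then 0 else cumulant φ a W) hVn
            fun W hW _ => (if_neg hW.ne).symm
          rw [hw, ncSum_eq_zero _ hVn] at hf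
          · simpa using hf.symm
          · intro j hj
            rw [cumulant_singleton hφ, h₀' j hj, ite_self]
          · intro W hW p hp q hq hpq hr
            by_cases hWV : W = V
            · exact if_pos hWV
            · rw [if_neg hWV]
              exact ih' a ha W (hW.ssubset_of_ne hWV)
                ⟨p, hp, q, hq, hadj p (hW hp) q (hW hq) hpq hr⟩
        | insert s S _ ihS =>
          intro hS a ha h₀
          have hs : s ∈ V := hS (Finset.mem_insert_self _ _)
          have hdec : Function.update a s
              ((1 : ℂ) • (a s - φ (a s) • (1 : A)) + φ (a s) • (1 : A)) = a := by
            rw [one_smul, sub_add_cancel, Function.update_eq_self]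
          have hne : V ≠ {s} := by
            rintro rfl
            obtain ⟨l, hl, k, hk, hlk⟩ := hmix
            rw [Finset.mem_singleton] at hl hk
            exact hlk (by rw [hl, hk])
          rw [← hdec, cumulant_update_linear hφ a hs,
            cumulant_eq_zero_of_one hφ (j := s) hs (Function.update_self _ _ _) hne, mul_zero,
            add_zero, one_mul]
          refine ihS ((Finset.subset_insert _ _).trans hS) _ (fun j hj => ?_) fun j hj hjS => ?_
          · by_cases hjs : j = s
            · subst hjs
              rw [Function.update_self]
              exact sub_mem (ha j hs) ((𝒜 _).smul_mem (one_mem _) _)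
            · rw [Function.update_of_ne hjs]
              exact ha j hj
          · by_cases hjs : j = s
            · subst hjs
              rw [Function.update_self, map_sub, map_smul, hφ, smul_eq_mul, mul_one, sub_self]
            · rw [Function.update_of_ne hjs]
              exact h₀ j hj (by simp [hjs, hjS])
      exact key V subset_rfl a ha fun j hj hjV => absurd hj hjV

/-- Vanishing of mixed free cumulants passes to words over an arbitrary index order. -/
theorem cumulant_eq_zero_of_freeCumulant (hφ : φ 1 = 1) {s : I → Set A}
    (H : ∀ n : ℕ, 2 ≤ n → ∀ (i : Fin n → I) (a : Fin n → A), (∀ j, a j ∈ s (i j)) →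
      (∃ l k, i l ≠ i k) → freeCumulant φ a = 0)
    {ι : Type*} [LinearOrder ι] (c : ι → I) (a : ι → A) {V : Finset ι}
    (ha : ∀ j ∈ V, a j ∈ s (c j)) (hmix : ∃ l ∈ V, ∃ k ∈ V, c l ≠ c k) :
    cumulant φ a V = 0 := by
  obtain ⟨l, hl, k, hk, hlk⟩ := hmix
  have hr : ∀ x ∈ V, ∃ y, V.orderEmbOfFin rfl y = x := by
    intro x hx
    have : x ∈ Set.range (V.orderEmbOfFin rfl) := by
      rw [Finset.range_orderEmbOfFin]
      exact hx
    exact this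
  rw [cumulant_eq_freeCumulant hφ a ⟨l, hl⟩]
  refine H _ ?_ (fun j => c (V.orderEmbOfFin rfl j)) _
    (fun j => ha _ (Finset.orderEmbOfFin_mem V rfl j)) ?_
  · exact Finset.one_lt_card.2 ⟨l, hl, k, hk, fun h => hlk (h ▸ rfl)⟩
  · obtain ⟨l', rfl⟩ := hr l hl
    obtain ⟨k', rfl⟩ := hr k hk
    exact ⟨l', k', hlk⟩

theorem isFree_iff_freeCumulant (hφ : φ 1 = 1) (𝒜 : I → Subalgebra ℂ A) :
    IsFree φ 𝒜 ↔ ∀ n : ℕ, 2 ≤ n → ∀ (i : Fin n → I) (a : Fin n → A), (∀ j, a j ∈ 𝒜 (i j)) →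
      (∃ l k, i l ≠ i k) → freeCumulant φ a = 0 := by
  constructor
  · rintro h n hn i a ha ⟨l, k, hlk⟩
    rw [freeCumulant_eq_cumulant hφ (by omega)]
    exact h.cumulant_eq_zero hφ i _ a (fun j _ => ha j)
      ⟨l, Finset.mem_univ _, k, Finset.mem_univ _, hlk⟩
  · intro H k hk i a ha hi h₀
    rw [moment_eq_word, ← ncSum_cumulant hφ]
    refine ncSum_eq_zero _ ⟨⟨0, hk⟩, Finset.mem_univ _⟩ (fun j _ => ?_) ?_
    · rw [cumulant_singleton hφ, h₀]
    · intro W _ p hp q hq hpq hr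
      refine cumulant_eq_zero_of_freeCumulant hφ (s := fun i => (𝒜 i : Set A)) H i a
        (fun j _ => ha j) ⟨p, hp, q, hq, hi p q ?_⟩
      have hpq' := Fin.lt_def.1 hpq
      by_contra hne
      -- If `q` were not the successor of `p`, then `p + 1` would lie strictly between them.
      refine hr ⟨p + 1, by omega⟩ (Finset.mem_univ _) ⟨Fin.lt_def.2 ?_, Fin.lt_def.2 ?_⟩
      · simp
      · simp only
        omega

/-- The letters of the word obtained by merging powers of `x (i j)` into the position `(j, 0)`. -/
def powerLetters (x : I → A) {n : ℕ} (i : Fin n → I) (t : Fin n → ℕ) (p : Fin n ×ₗ ℕ) : A :=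
  if (ofLex p).2 = 0 then x (i (ofLex p).1) ^ t (ofLex p).1 else x (i (ofLex p).1)

/-- Induction on the exponents. The lexicographic order leaves room behind each `(j, 0)` to split
one factor off a power and store it at `(j, t j)`. `hW` keeps that position free and everything
between it and `(j, 0)` out of `W`. -/
theorem cumulant_powerLetters_eq_zero (hφ : φ 1 = 1) {x : I → A}
    (H : ∀ n : ℕ, 2 ≤ n → ∀ i : Fin n → I,
      (∃ l k, i l ≠ i k) → freeCumulant φ (fun j => x (i j)) = 0)
    {n : ℕ} (i : Fin n → I) (t : Fin n → ℕ) (W : Finset (Fin n ×ₗ ℕ))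
    (hW : ∀ p ∈ W, (ofLex p).2 = 0 ∨ t (ofLex p).1 < (ofLex p).2)
    (hmix : ∃ l ∈ W, ∃ k ∈ W, i (ofLex l).1 ≠ i (ofLex k).1) :
    cumulant φ (powerLetters x i t) W = 0 := by
  induction t using WellFoundedLT.induction generalizing W with
  | ind t ih =>
    by_cases ht : ∃ j, t j ≠ 0
    · obtain ⟨j, hj⟩ := ht
      obtain ⟨s, hs⟩ := Nat.exists_eq_succ_of_ne_zero hj
      have ht' : Function.update t j s < t := update_lt_self_iff.2 (by omega)
      set p : Fin n ×ₗ ℕ := toLex (j, 0) with hp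
      set q : Fin n ×ₗ ℕ := toLex (j, s + 1) with hq
      have hpq : p < q := by
        rw [hp, hq, Prod.Lex.toLex_lt_toLex]
        simp
      have hm : powerLetters x i t = mergeLetters (powerLetters x i (Function.update t j s)) p q := by
        funext r
        by_cases hr : r = p
        · subst hr
          simp [mergeLetters, powerLetters, hp, hq, hs, pow_succ]
        · rw [mergeLetters, Function.update_of_ne hr]
          unfold powerLetters
          split_ifs with h0
          · have : (ofLex r).1 ≠ j := fun h => hr (by
              rw [hp, ← h, ← h0]
              rfl)
            rw [Function.update_of_ne this]
          · rfl
      have hqW : q ∉ W := by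
        intro h
        have := hW q h
        simp [hq, hs] at this
      have hadj : ∀ r ∈ insert p (insert q W), ¬(p < r ∧ r < q) := by
        rintro r hr ⟨h₁, h₂⟩
        rcases Finset.mem_insert.1 hr with rfl | hr
        · exact lt_irrefl _ h₁
        rcases Finset.mem_insert.1 hr with rfl | hr
        · exact lt_irrefl _ h₂
        have h₃ := hW r hr
        rw [hp, Prod.Lex.lt_iff] at h₁
        rw [hq, Prod.Lex.lt_iff] at h₂
        simp only [ofLex_toLex] at h₁ h₂
        rcases h₁ with h₁ | ⟨h₁, h₁'⟩
        · rcases h₂ with h₂ | ⟨h₂, h₂'⟩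
          · exact lt_asymm h₁ h₂
          · exact h₁.ne' h₂
        · rcases h₂ with h₂ | ⟨h₂, h₂'⟩
          · exact h₂.ne' h₁
          · rw [← h₁, hs] at h₃
            omega
      rw [hm]
      refine mixed_cumulant_mergeLetters hφ (fun r => i (ofLex r).1) _
        (V := insert p (insert q W)) (by simp) (by simp) hpq hadj (by simp [hp, hq])
        (Finset.subset_erase.2 ⟨fun r hr => by simp [hr], hqW⟩) hmix fun X hX hmX =>
          ih _ ht' X (fun r hr => ?_) hmX
      rcases Finset.mem_insert.1 (hX hr) with rfl | hr'
      · right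
        simp [hq]
      · refine (hW r hr').imp_right fun h => ?_
        exact (ht'.le (ofLex r).1).trans_lt h
    -- All exponents are zero: a position `(j, 0)` carries the letter `1`, and every other position
    -- carries a generator.
    · push Not at ht
      by_cases h1 : ∃ p ∈ W, (ofLex p).2 = 0
      · obtain ⟨p, hp, hp0⟩ := h1
        refine cumulant_eq_zero_of_one hφ hp (by simp [powerLetters, hp0, ht]) ?_
        rintro rfl
        obtain ⟨l, hl, k, hk, hlk⟩ := hmix
        rw [Finset.mem_singleton] at hl hk
        exact hlk (by rw [hl, hk])
      · push Not at h1
        refine cumulant_eq_zero_of_freeCumulant hφ (s := fun i => {x i}) ?_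
          (fun r => i (ofLex r).1) _ (fun r hr => ?_) hmix
        · intro m hm i' a ha
          obtain rfl : a = fun j => x (i' j) := funext ha
          exact H m hm i'
        · simp [powerLetters, h1 r hr]

theorem cumulant_pow_eq_zero (hφ : φ 1 = 1) {x : I → A}
    (H : ∀ n : ℕ, 2 ≤ n → ∀ i : Fin n → I,
      (∃ l k, i l ≠ i k) → freeCumulant φ (fun j => x (i j)) = 0)
    {n : ℕ} (i : Fin n → I) (m : Fin n → ℕ) (hmix : ∃ l k, i l ≠ i k) :
    cumulant φ (fun j => x (i j) ^ m j) Finset.univ = 0 := by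
  obtain ⟨l, k, hlk⟩ := hmix
  let e : Fin n ↪o Fin n ×ₗ ℕ := OrderEmbedding.ofStrictMono (fun j => toLex (j, 0))
    fun a b hab => by
      rw [Prod.Lex.toLex_lt_toLex]
      exact Or.inl hab
  have h₁ := cumulant_map hφ e (powerLetters x i m) (V := Finset.univ) ⟨l, Finset.mem_univ l⟩
  have h₂ : (fun j => powerLetters x i m (e j)) = fun j => x (i j) ^ m j := rfl
  rw [← h₂, ← h₁]
  refine cumulant_powerLetters_eq_zero hφ H i m _ (fun p hp => ?_)
    ⟨e l, by simp, e k, by simp, hlk⟩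
  obtain ⟨j, -, rfl⟩ := Finset.mem_map.1 hp
  exact Or.inl rfl

/-- The algebra generated by one element is spanned by its powers. Entries outside `S` are already
powers, and multilinearity treats those in `S` one by one. -/
theorem cumulant_adjoin_eq_zero (hφ : φ 1 = 1) {x : I → A}
    (H : ∀ n : ℕ, 2 ≤ n → ∀ i : Fin n → I,
      (∃ l k, i l ≠ i k) → freeCumulant φ (fun j => x (i j)) = 0)
    {n : ℕ} (i : Fin n → I) (hmix : ∃ l k, i l ≠ i k) (S : Finset (Fin n)) (a : Fin n → A)
    (ha : ∀ j ∈ S, a j ∈ Algebra.adjoin ℂ {x (i j)}) (ha' : ∀ j ∉ S, ∃ m : ℕ, x (i j) ^ m = a j) :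
    cumulant φ a Finset.univ = 0 := by
  induction S using Finset.induction_on generalizing a with
  | empty =>
    choose m hm using fun j => ha' j (Finset.notMem_empty j)
    obtain rfl : (fun j => x (i j) ^ m j) = a := funext hm
    exact cumulant_pow_eq_zero hφ H i m hmix
  | insert s S hsS ih =>
    have hs := ha s (Finset.mem_insert_self s S)
    rw [← Subalgebra.mem_toSubmodule, Algebra.adjoin_eq_span] at hs
    rw [← Function.update_eq_self s a]
    have hlin := cumulant_update_linear hφ a (Finset.mem_univ s)
    -- Only the value put into slot `s` varies in the span induction; the rest of `a` stays fixed.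
    generalize a s = y at hs ⊢
    induction hs using Submodule.span_induction with
    | mem y hy =>
      refine ih _ (fun j hj => ?_) fun j hj => ?_
      · have : j ≠ s := fun h => hsS (h ▸ hj)
        rw [Function.update_of_ne this]
        exact ha j (Finset.mem_insert_of_mem hj)
      · by_cases hjs : j = s
        · subst hjs
          rw [Function.update_self]
          exact Submonoid.mem_closure_singleton.1 hy
        · rw [Function.update_of_ne hjs]
          exact ha' j (by simp [hjs, hj])
    | zero => simpa using hlin 0 0 0 0
    | add y z _ _ hy hz => simpa [hy, hz] using hlin 1 1 y z
    | smul r y _ hy => simpa [hy] using hlin r 0 y 0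

end Main

end FreeProb

theorem mainTheorem2 {A : Type*} [Ring A] [Algebra ℂ A] (φ : A →ₗ[ℂ] ℂ) (hφ : φ 1 = 1)
    {I : Type*} :
    (∀ 𝒜 : I → Subalgebra ℂ A,
      FreeProb.IsFree φ 𝒜 ↔
        ∀ n : ℕ, 2 ≤ n → ∀ (i : Fin n → I) (a : Fin n → A), (∀ j, a j ∈ 𝒜 (i j)) →
          (∃ l k, i l ≠ i k) → FreeProb.freeCumulant φ a = 0) ∧
    (∀ x : I → A,
      FreeProb.IsFreeRV φ x ↔
        ∀ n : ℕ, 2 ≤ n → ∀ i : Fin n → I,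
          (∃ l k, i l ≠ i k) → FreeProb.freeCumulant φ (fun j => x (i j)) = 0) := by
  refine ⟨FreeProb.isFree_iff_freeCumulant hφ, fun x => ?_⟩
  rw [FreeProb.IsFreeRV, FreeProb.isFree_iff_freeCumulant hφ]
  constructor
  · exact fun H n hn i => H n hn i _ fun j => Algebra.self_mem_adjoin_singleton ℂ (x (i j))
  · intro H n hn i a ha hmix
    rw [FreeProb.freeCumulant_eq_cumulant hφ (by omega)]
    exact FreeProb.cumulant_adjoin_eq_zero hφ H i hmix Finset.univ a (fun j _ => ha j)
      fun j hj => absurd (Finset.mem_univ j) hj
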